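/- Let $n,m\ge 1$, let $\sigma$ be the uniform probability measure on the unit sphere $S=\mathcal S^{n-1}\subset\mathbb R^n$, and let $\rho(v,w)=\arccos\langle v,w\rangle$ be the geodesic distance on $S$. Let $\operatorname{sign}(t)=1$ for $t>0$, $\operatorname{sign}(t)=-1$ for $t<0$, and let $\operatorname{sign}(0)\in\{-1,1\}$ be an arbitrary fixed value. For $u\in S$ and $\mathbf x=(x_1,\dots,x_m)\in S^m$ put $u(\mathbf x)=(\operatorname{sign}\langle u,x_i\rangle)_{i\le m}$. A learning rule is a measurable map $f:S^m\times\{-1,1\}^m\to S$; its expected misclassification probability is $$\Omega(f)=\mathbb E_{u\sim\sigma}\,\mathbb E_{\mathbf x\sim\sigma^m}\Pr_{x\sim\sigma}\{\operatorname{sign}\langle f(\mathbf x,u(\mathbf x)),x\rangle\ne\operatorname{sign}\langle u,x\rangle\},$$ and $f$ is called optimal if it minimizes $\Omega$ among all learning rules. For $\mathbf x\in S^m$, $\mathbf y\in\{-1,1\}^m$ let $K(\mathbf x,\mathbf y)=\{v\in\mathbb R^n:\langle v,y_ix_i\rangle\ge 0\ \text{for } 1\le i\le m\}$, and for $K\subseteq\mathbb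 R^n$ and $w\in S$ let $\psi_K(w)=\int_{K\cap S}\rho(w,u)\,d\sigma(u)$. Then: 1. For all $v,u\in S$: $\Pr_{x\sim\sigma}\{\operatorname{sign}\langle v,x\rangle\ne\operatorname{sign}\langle u,x\rangle\}=\rho(v,u)/\pi$. 2. For every learning rule $f$, $\Omega(f)=\pi^{-1}\,\mathbb E_{\mathbf x\sim\sigma^m}\sum_{\mathbf y\in\{-1,1\}^m}\psi_{K(\mathbf x,\mathbf y)}(f(\mathbf x,\mathbf y))$, where the functions under the expectations are integrable. 3. If $K(\mathbf x,\mathbf y)$ has empty interior, then $\psi_{K(\mathbf x,\mathbf y)}$ is identically $0$. 4. There is an optimal learning rule $f^*$ such that: (a) for all $(\mathbf x,\mathbf y)$ for which $K(\mathbf x,\mathbf y)$ has nonempty interior, $f^*(\mathbf x,\mathbf y)$ is the unique global minimizer of $\psi_{K(\mathbf x,\mathbf y)}$ on $S$, it lies in $\{\sum_{i}\alpha_iy_ix_i:\alpha_i\ge 0\}$, and, if $n\ge 2$, $\psi_{K(\mathbf x,\mathbf y)}$ has no other local minimum on $S$; (b) $f^*$ is the unique optimal learning rule, in the sense that a learning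 rule $f$ is optimal if and only if for $\sigma^m$-almost every $\mathbf x$ we have $f(\mathbf x,\mathbf y)=f^*(\mathbf x,\mathbf y)$ for all $\mathbf y$ such that $K(\mathbf x,\mathbf y)$ has nonempty interior; (c) $f^*(V\mathbf x,\mathbf y)=Vf^*(\mathbf x,\mathbf y)$ for every orthogonal map $V$ of $\mathbb R^n$ and all $(\mathbf x,\mathbf y)$, where $V\mathbf x=(Vx_1,\dots,Vx_m)$. -/

import Mathlib

open MeasureTheory Set
open scoped RealInnerProductSpace

namespace HalfspaceLearning

noncomputable section

/-- The space `ℝⁿ` with its Euclidean structure. -/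
abbrev E (n : ℕ) : Type := EuclideanSpace ℝ (Fin n)

/-- The unit sphere of `ℝⁿ`. -/
abbrev Sph (n : ℕ) : Type := Metric.sphere (0 : E n) 1

/-- The uniform probability measure on the unit sphere: normalized surface measure. -/
def unif (n : ℕ) : Measure (Sph n) :=
  ((volume : Measure (E n)).toSphere univ)⁻¹ • (volume : Measure (E n)).toSphere

/-- The law of `m` independent uniform points of the sphere. -/
def sampleLaw (n m : ℕ) : Measure (Fin m → Sph n) :=
  Measure.pi fun _ => unif n

/-- The geodesic distance on the unit sphere: the angle between two unit vectors. -/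
def geo {n : ℕ} (v w : Sph n) : ℝ :=
  InnerProductGeometry.angle (v : E n) (w : E n)

/-- The sign of a real number, with values in `{-1, 1}`; the value at `0` is `s₀`. -/
def sgn (s₀ : ℤˣ) (t : ℝ) : ℤˣ :=
  if 0 < t then 1 else if t < 0 then -1 else s₀

/-- The label vector which the halfspace with normal `u` assigns to the sample `x`. -/
def label {n m : ℕ} (s₀ : ℤˣ) (u : Sph n) (x : Fin m → Sph n) : Fin m → ℤˣ :=
  fun i => sgn s₀ ⟪(u : E n), (x i : E n)⟫

/-- The probability that a uniform test point is labeled differently by the halfspaces with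
normals `v` and `u`. -/
def disagree {n : ℕ} (s₀ : ℤˣ) (v u : Sph n) : ℝ :=
  (unif n).real {t : Sph n |
    sgn s₀ ⟪(v : E n), (t : E n)⟫ ≠ sgn s₀ ⟪(u : E n), (t : E n)⟫}

/-- A learning rule: a map from labeled samples to hypotheses. -/
abbrev Rule (n m : ℕ) : Type := (Fin m → Sph n) × (Fin m → ℤˣ) → Sph n

/-- The expected misclassification probability `Ω(f)` of a learning rule `f`. -/
def risk {n m : ℕ} (s₀ : ℤˣ) (f : Rule n m) : ℝ :=
  ∫ u, ∫ x, disagree s₀ (f (x, label s₀ u x)) u ∂(sampleLaw n m) ∂(unif n)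

/-- A measurable learning rule is optimal if it minimizes `Ω` among measurable rules. -/
def IsOptimal {n m : ℕ} (s₀ : ℤˣ) (f : Rule n m) : Prop :=
  Measurable f ∧ ∀ g : Rule n m, Measurable g → risk s₀ f ≤ risk s₀ g

/-- The signed example `yᵢ xᵢ`. -/
def signed {n m : ℕ} (x : Fin m → Sph n) (y : Fin m → ℤˣ) (i : Fin m) : E n :=
  (((y i : ℤˣ) : ℤ) : ℝ) • (x i : E n)

/-- The closed version-space cone `K(x, y)`. -/
def cone {n m : ℕ} (x : Fin m → Sph n) (y : Fin m → ℤˣ) : Set (E n) :=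
  {v | ∀ i, 0 ≤ ⟪v, signed x y i⟫}

/-- `ψ_K(w)`, the integral over `K ∩ S` of the geodesic distance to `w`. -/
def psi {n : ℕ} (K : Set (E n)) (w : Sph n) : ℝ :=
  ∫ u in {u : Sph n | (u : E n) ∈ K}, geo w u ∂(unif n)

/-- The action of an orthogonal map on the unit sphere. -/
def act {n : ℕ} (V : E n ≃ₗᵢ[ℝ] E n) (w : Sph n) : Sph n :=
  ⟨V w, by simp⟩

end

end HalfspaceLearning

namespace HalfspaceLearning

open Filter Topology Pointwise

/-! ### The uniform measure on the sphere -/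

/-! Along a great circle the disagreement probability is additive and nonnegative, hence linear, and
it equals 1 at antipodes; this gives ρ/π (`disagree_eq_geo_div_pi`). For fixed examples the labels
sort almost every target u into exactly one cone K(x, y), so Fubini turns the risk into an average
of sums of ψ (`risk_eq`). Minimizing the risk thus means minimizing each ψ_K separately.

The engine is folding. If b ∈ K, reflection in b^⊥ sends the part of K in the hemisphere opposite b
back into K. So an integrand that is odd under this reflection and nonnegative on the hemisphere of
b has nonnegative integral over K. This yields strict midpoint convexity of ψ_K along great circles
at points of the open cone (`psi_midpoint_lt`), and ψ_K does not increase when w with ⟨w, b⟩ ≤ 0 is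
reflected (`psi_act_refl_le`).

For n ≥ 2 a local minimum w lies in the open cone: if -w does, ψ is strictly midpoint concave at w;
if neither does, a hyperplane through w bounds a halfspace containing the open cone, and moving
towards it decreases ψ to first order. Strict convexity on arcs then gives uniqueness. By uniqueness
and folding, the minimizer has nonnegative inner product with all of K, so Farkas puts it in the
cone generated by the signed examples. Joint continuity of ψ and uniqueness make the minimizer
continuous in x, hence measurable; uniqueness also gives equivariance and the almost everywhere
statement. -/

theorem inner_self_sph {n : ℕ} (v : Sph n) : ⟪(v : E n), (v : E n)⟫ = 1 := by
  rw [real_inner_self_eq_norm_sq, norm_eq_of_mem_sphere, one_pow]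

theorem sph_ne_zero {n : ℕ} (v : Sph n) : (v : E n) ≠ 0 := ne_zero_of_mem_unit_sphere v

instance isFiniteMeasure_unif (n : ℕ) : IsFiniteMeasure (unif n) := by
  rcases Nat.eq_zero_or_pos n with rfl | hn
  · have : IsEmpty (Sph 0) :=
      ⟨fun v => sph_ne_zero v (Subsingleton.elim _ _)⟩
    exact ⟨by simp [Set.univ_eq_empty_iff.2 this]⟩
  · have : NeZero n := ⟨hn.ne'⟩
    refine ⟨?_⟩
    rw [unif, Measure.smul_apply, smul_eq_mul]
    refine ENNReal.mul_lt_top (ENNReal.inv_lt_top.2 ?_) (measure_lt_top _ _)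
    exact pos_iff_ne_zero.2 (Measure.measure_univ_ne_zero.2 (Measure.toSphere_ne_zero _))

theorem isProbabilityMeasure_unif {n : ℕ} (hn : 1 ≤ n) : IsProbabilityMeasure (unif n) := by
  have : NeZero n := ⟨by omega⟩
  refine ⟨?_⟩
  rw [unif, Measure.smul_apply, smul_eq_mul]
  exact ENNReal.inv_mul_cancel (Measure.measure_univ_ne_zero.2 (Measure.toSphere_ne_zero _))
    (measure_ne_top _ _)

instance isOpenPosMeasure_unif (n : ℕ) : (unif n).IsOpenPosMeasure :=
  Measure.isOpenPosMeasure_smul _ (ENNReal.inv_ne_zero.2 (measure_ne_top _ _))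

/-- The truncated cone over this great subsphere lies in the proper subspace v^⊥, which is Lebesgue
null. -/
theorem unif_inner_eq_zero {n : ℕ} (v : Sph n) :
    unif n {u : Sph n | ⟪(u : E n), (v : E n)⟫ = 0} = 0 := by
  have hm : MeasurableSet {u : Sph n | ⟪(u : E n), (v : E n)⟫ = 0} :=
    measurableSet_eq_fun (by fun_prop) measurable_const
  rw [unif, Measure.smul_apply, Measure.toSphere_apply' _ hm]
  have hsub : Ioo (0 : ℝ) 1 • ((fun u : Sph n => (u : E n)) ''
      {u : Sph n | ⟪(u : E n), (v : E n)⟫ = 0}) ⊆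
      (((ℝ ∙ (v : E n))ᗮ : Submodule ℝ (E n)) : Set (E n)) := by
    rintro _ ⟨r, -, _, ⟨u, hu, rfl⟩, rfl⟩
    rw [SetLike.mem_coe, Submodule.mem_orthogonal_singleton_iff_inner_left]
    simp only [mem_ofPred_eq] at hu
    simp [inner_smul_left, hu]
  have hne : ((ℝ ∙ (v : E n))ᗮ : Submodule ℝ (E n)) ≠ ⊤ := by
    intro h
    have : (v : E n) ∈ ((ℝ ∙ (v : E n))ᗮ : Submodule ℝ (E n)) := h ▸ Submodule.mem_top
    rw [Submodule.mem_orthogonal_singleton_iff_inner_left, inner_self_sph] at this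
    exact one_ne_zero this
  rw [measure_mono_null hsub (Measure.addHaar_submodule _ _ hne)]
  simp

theorem ae_inner_ne_zero {n : ℕ} (v : Sph n) :
    ∀ᵐ u : Sph n ∂(unif n), ⟪(u : E n), (v : E n)⟫ ≠ 0 := by
  rw [ae_iff]; simpa using unif_inner_eq_zero v

theorem continuous_act {n : ℕ} (V : E n ≃ₗᵢ[ℝ] E n) : Continuous (act V) :=
  (V.continuous.comp continuous_subtype_val).subtype_mk _

@[simp] theorem coe_act {n : ℕ} (V : E n ≃ₗᵢ[ℝ] E n) (w : Sph n) : (act V w : E n) = V w := rfl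

theorem act_symm_act {n : ℕ} (V : E n ≃ₗᵢ[ℝ] E n) (w : Sph n) : act V.symm (act V w) = w :=
  Subtype.ext (by simp)

theorem act_act_symm {n : ℕ} (V : E n ≃ₗᵢ[ℝ] E n) (w : Sph n) : act V (act V.symm w) = w :=
  Subtype.ext (by simp)

/-- Spherical measure is computed from the volume of truncated cones, and V commutes with forming
them and preserves volume. -/
theorem measurePreserving_act {n : ℕ} (V : E n ≃ₗᵢ[ℝ] E n) :
    MeasurePreserving (act V) (unif n) (unif n) := by
  refine ⟨(continuous_act V).measurable, ?_⟩
  ext s hs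
  rw [Measure.map_apply (continuous_act V).measurable hs, unif, Measure.smul_apply,
    Measure.smul_apply, Measure.toSphere_apply' _ hs,
    Measure.toSphere_apply' _ ((continuous_act V).measurable hs)]
  have : Ioo (0 : ℝ) 1 • ((fun u : Sph n => (u : E n)) '' (act V ⁻¹' s)) =
      V ⁻¹' (Ioo (0 : ℝ) 1 • ((fun u : Sph n => (u : E n)) '' s)) := by
    ext z
    constructor
    · rintro ⟨r, hr, _, ⟨u, hu, rfl⟩, rfl⟩
      exact ⟨r, hr, _, ⟨act V u, hu, rfl⟩, by simp⟩
    · rintro ⟨r, hr, _, ⟨u, hu, rfl⟩, h⟩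
      refine ⟨r, hr, _, ⟨act V.symm u, ?_, rfl⟩, ?_⟩
      · rwa [mem_preimage, act_act_symm]
      · apply V.injective
        simpa using h
  have hV : ∀ A : Set (E n), volume (V ⁻¹' A) = volume A := fun A =>
    V.measurePreserving.measure_preimage_emb V.toHomeomorph.measurableEmbedding A
  rw [this, hV]

theorem measurableEmbedding_act {n : ℕ} (V : E n ≃ₗᵢ[ℝ] E n) : MeasurableEmbedding (act V) :=
  (Homeomorph.mk ⟨act V, act V.symm, act_symm_act V, act_act_symm V⟩ (continuous_act V)
    (continuous_act V.symm)).measurableEmbedding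

/-- The reflection of `ℝⁿ` in the hyperplane orthogonal to `b`. -/
noncomputable def refl {n : ℕ} (b : Sph n) : E n ≃ₗᵢ[ℝ] E n := ((ℝ ∙ (b : E n))ᗮ).reflection

theorem refl_apply {n : ℕ} (b : Sph n) (x : E n) :
    refl b x = x - (2 * ⟪(b : E n), x⟫) • (b : E n) := by
  rw [refl, Submodule.reflection_orthogonal_apply, Submodule.reflection_singleton_apply]
  simp [two_smul, two_mul, add_smul]

theorem refl_refl {n : ℕ} (b : Sph n) (x : E n) : refl b (refl b x) = x :=
  Submodule.reflection_reflection _ _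

theorem act_refl_act_refl {n : ℕ} (b w : Sph n) : act (refl b) (act (refl b) w) = w :=
  Subtype.ext (refl_refl b w)

/-! ### Geodesic distance -/

theorem geo_eq_arccos {n : ℕ} (v w : Sph n) : geo v w = Real.arccos ⟪(v : E n), (w : E n)⟫ := by
  simp [geo, InnerProductGeometry.angle]

theorem cos_geo {n : ℕ} (v w : Sph n) : Real.cos (geo v w) = ⟪(v : E n), (w : E n)⟫ := by
  simp [geo, InnerProductGeometry.cos_angle]

theorem geo_nonneg {n : ℕ} (v w : Sph n) : 0 ≤ geo v w := InnerProductGeometry.angle_nonneg _ _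

theorem geo_le_pi {n : ℕ} (v w : Sph n) : geo v w ≤ Real.pi := InnerProductGeometry.angle_le_pi _ _

theorem geo_comm {n : ℕ} (v w : Sph n) : geo v w = geo w v := InnerProductGeometry.angle_comm _ _

theorem geo_self {n : ℕ} (v : Sph n) : geo v v = 0 :=
  InnerProductGeometry.angle_self (sph_ne_zero v)

theorem geo_neg_left {n : ℕ} (v w : Sph n) : geo (-v) w = Real.pi - geo v w :=
  InnerProductGeometry.angle_neg_left _ _

theorem geo_triangle {n : ℕ} (u v w : Sph n) : geo u w ≤ geo u v + geo v w :=
  InnerProductGeometry.angle_le_angle_add_angle _ _ _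

theorem abs_geo_sub_le {n : ℕ} (u v w : Sph n) : |geo u w - geo v w| ≤ geo u v := by
  rw [abs_le]
  constructor
  · linarith [geo_triangle v u w, geo_comm u v]
  · linarith [geo_triangle u v w]

theorem eq_of_geo_eq_zero {n : ℕ} {v w : Sph n} (h : geo v w = 0) : v = w :=
  Subtype.ext (InnerProductGeometry.eq_of_angle_eq_zero_of_norm_eq h (by simp))

theorem eq_neg_of_geo_eq_pi {n : ℕ} {v w : Sph n} (h : geo v w = Real.pi) : w = -v := by
  have : geo (-v) w = 0 := by rw [geo_neg_left, h, sub_self]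
  exact (eq_of_geo_eq_zero this).symm

theorem geo_act_act {n : ℕ} (V : E n ≃ₗᵢ[ℝ] E n) (v w : Sph n) :
    geo (act V v) (act V w) = geo v w := by
  simp [geo_eq_arccos]

theorem geo_le_geo {n : ℕ} {v w u : Sph n} (h : ⟪(v : E n), (u : E n)⟫ ≤ ⟪(w : E n), (u : E n)⟫) :
    geo w u ≤ geo v u := by
  rw [geo_eq_arccos, geo_eq_arccos]
  exact Real.antitone_arccos h

/-! ### Great circles -/

/-- The point at parameter `t` of the great circle through two orthogonal unit vectors. -/
noncomputable def arc {n : ℕ} (e f : Sph n) (hef : ⟪(e : E n), (f : E n)⟫ = 0) (t : ℝ) : Sph n :=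
  ⟨Real.cos t • (e : E n) + Real.sin t • (f : E n), by
    have h : ‖Real.cos t • (e : E n) + Real.sin t • (f : E n)‖ ^ 2 = 1 := by
      rw [← real_inner_self_eq_norm_sq]
      have h' : ⟪(f : E n), (e : E n)⟫ = 0 := by rw [real_inner_comm]; exact hef
      simp only [inner_add_left, inner_add_right, inner_smul_left, inner_smul_right,
        inner_self_sph, hef, h']
      simp only [conj_trivial]
      nlinarith [Real.sin_sq_add_cos_sq t]
    rw [mem_sphere_zero_iff_norm]
    exact (pow_eq_one_iff_of_nonneg (norm_nonneg _) two_ne_zero).1 h⟩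

section GreatCircle

variable {n : ℕ} {e f : Sph n} (hef : ⟪(e : E n), (f : E n)⟫ = 0)

theorem coe_arc (t : ℝ) :
    (arc e f hef t : E n) = Real.cos t • (e : E n) + Real.sin t • (f : E n) := rfl

theorem continuous_arc : Continuous (arc e f hef) := by
  apply Continuous.subtype_mk
  fun_prop

theorem inner_arc_left (t : ℝ) (u : E n) : ⟪(arc e f hef t : E n), u⟫ =
    Real.cos t * ⟪(e : E n), u⟫ + Real.sin t * ⟪(f : E n), u⟫ := by
  simp [coe_arc, inner_add_left, inner_smul_left]

theorem inner_arc_arc (s t : ℝ) :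
    ⟪(arc e f hef s : E n), (arc e f hef t : E n)⟫ = Real.cos (s - t) := by
  have h' : ⟪(f : E n), (e : E n)⟫ = 0 := by rw [real_inner_comm]; exact hef
  rw [inner_arc_left, coe_arc]
  simp only [inner_add_right, inner_smul_right, inner_self_sph, hef, h', Real.cos_sub]
  ring

theorem arc_zero : arc e f hef 0 = e := Subtype.ext (by simp [coe_arc])

theorem arc_add_pi (t : ℝ) : arc e f hef (t + Real.pi) = -arc e f hef t :=
  Subtype.ext (by simp [coe_arc]; abel)

/-- In the plane of the circle this is the reflection in the line at angle s + π/2, so reflections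
become affine maps of the parameter. -/
theorem refl_arc (s t : ℝ) :
    act (refl (arc e f hef s)) (arc e f hef t) = arc e f hef (2 * s + Real.pi - t) := by
  apply Subtype.ext
  have h1 : Real.cos (2 * s + Real.pi - t) = Real.cos t - 2 * Real.cos (s - t) * Real.cos s := by
    rw [show 2 * s + Real.pi - t = (s - t) + s + Real.pi by ring, Real.cos_add_pi, Real.cos_add]
    have : Real.cos t = Real.cos (s - (s - t)) := by ring_nf
    rw [this, Real.cos_sub s (s - t)]
    ring
  have h2 : Real.sin (2 * s + Real.pi - t) = Real.sin t - 2 * Real.cos (s - t) * Real.sin s := by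
    rw [show 2 * s + Real.pi - t = (s - t) + s + Real.pi by ring, Real.sin_add_pi, Real.sin_add]
    have : Real.sin t = Real.sin (s - (s - t)) := by ring_nf
    rw [this, Real.sin_sub s (s - t)]
    ring
  rw [coe_act, refl_apply, inner_arc_arc, coe_arc, coe_arc, coe_arc, h1, h2]
  module

theorem geo_arc_le (s t : ℝ) : geo (arc e f hef s) (arc e f hef t) ≤ |s - t| := by
  rw [geo_eq_arccos, inner_arc_arc, ← Real.cos_abs]
  rcases le_total |s - t| Real.pi with h | h
  · rw [Real.arccos_cos (abs_nonneg _) h]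
  · exact (Real.arccos_le_pi _).trans h

/-- Gram–Schmidt: f is the normalized component of w orthogonal to v, whose length is the sine of
the angle. -/
theorem exists_arc_eq {v w : Sph n} (h0 : v ≠ w) (h1 : w ≠ -v) :
    ∃ (f : Sph n) (hvf : ⟪(v : E n), (f : E n)⟫ = 0), w = arc v f hvf (geo v w) := by
  have hs : 0 < Real.sin (geo v w) := by
    apply Real.sin_pos_of_pos_of_lt_pi
    · exact lt_of_le_of_ne (geo_nonneg v w) fun h => h0 (eq_of_geo_eq_zero h.symm)
    · exact lt_of_le_of_ne (geo_le_pi v w) fun h => h1 (eq_neg_of_geo_eq_pi h)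
  set s := Real.sin (geo v w) with hsdef
  set c := Real.cos (geo v w) with hcdef
  have hc : ⟪(v : E n), (w : E n)⟫ = c := (cos_geo v w).symm
  have hc' : ⟪(w : E n), (v : E n)⟫ = c := by rw [real_inner_comm]; exact hc
  have hsc : s ^ 2 + c ^ 2 = 1 := Real.sin_sq_add_cos_sq _
  have hn : ‖s⁻¹ • ((w : E n) - c • (v : E n))‖ = 1 := by
    have : ‖s⁻¹ • ((w : E n) - c • (v : E n))‖ ^ 2 = 1 := by
      rw [← real_inner_self_eq_norm_sq]
      simp only [inner_sub_left, inner_sub_right, inner_smul_left, inner_smul_right,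
        inner_self_sph, hc, hc', conj_trivial]
      field_simp
      linarith
    exact (pow_eq_one_iff_of_nonneg (norm_nonneg _) two_ne_zero).1 this
  refine ⟨⟨s⁻¹ • ((w : E n) - c • (v : E n)), mem_sphere_zero_iff_norm.2 hn⟩, ?_, ?_⟩
  · simp only [inner_sub_right, inner_smul_right, inner_self_sph, hc]
    ring
  · apply Subtype.ext
    simp only [coe_arc]
    rw [← hsdef, ← hcdef, smul_smul, mul_inv_cancel₀ hs.ne', one_smul]
    abel

end GreatCircle

/-! ### The disagreement probability -/

instance measurableSingletonClass_intUnits : MeasurableSingletonClass ℤˣ :=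
  ⟨fun a => ⟨{(a : ℤ)}, measurableSet_singleton _, by ext b; simp [Units.ext_iff]⟩⟩

theorem measurable_sgn (s₀ : ℤˣ) : Measurable (sgn s₀) :=
  Measurable.ite measurableSet_Ioi measurable_const
    (Measurable.ite measurableSet_Iio measurable_const measurable_const)

theorem sgn_eq_sgn_iff (s₀ : ℤˣ) {a b : ℝ} (ha : a ≠ 0) (hb : b ≠ 0) :
    sgn s₀ a = sgn s₀ b ↔ (0 < a ↔ 0 < b) := by
  have h1 : (-1 : ℤˣ) ≠ 1 := by decide
  rcases lt_or_gt_of_ne ha with ha | ha <;> rcases lt_or_gt_of_ne hb with hb | hb <;>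
    simp [sgn, ha, hb, ha.not_gt, hb.not_gt, h1, h1.symm]

theorem measurableSet_disagree {n : ℕ} (s₀ : ℤˣ) (v u : Sph n) :
    MeasurableSet {t : Sph n | sgn s₀ ⟪(v : E n), (t : E n)⟫ ≠ sgn s₀ ⟪(u : E n), (t : E n)⟫} :=
  (measurableSet_eq_fun ((measurable_sgn s₀).comp (by fun_prop))
    ((measurable_sgn s₀).comp (by fun_prop))).compl

theorem disagree_comm {n : ℕ} (s₀ : ℤˣ) (v u : Sph n) : disagree s₀ v u = disagree s₀ u v := by
  simp only [disagree, ne_comm]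

theorem disagree_self {n : ℕ} (s₀ : ℤˣ) (v : Sph n) : disagree s₀ v v = 0 := by
  simp [disagree]

theorem disagree_nonneg {n : ℕ} (s₀ : ℤˣ) (v u : Sph n) : 0 ≤ disagree s₀ v u :=
  measureReal_nonneg

theorem disagree_act {n : ℕ} (s₀ : ℤˣ) (V : E n ≃ₗᵢ[ℝ] E n) (v u : Sph n) :
    disagree s₀ (act V v) (act V u) = disagree s₀ v u := by
  rw [disagree, Measure.real, ← (measurePreserving_act V).measure_preimage
    (measurableSet_disagree s₀ _ _).nullMeasurableSet]
  simp [disagree, Measure.real]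

theorem ae_inner_ne_zero' {n : ℕ} (v : Sph n) :
    ∀ᵐ u : Sph n ∂(unif n), ⟪(v : E n), (u : E n)⟫ ≠ 0 := by
  filter_upwards [ae_inner_ne_zero v] with u hu
  rwa [real_inner_comm]

theorem disagree_neg {n : ℕ} (hn : 1 ≤ n) (s₀ : ℤˣ) (v : Sph n) : disagree s₀ v (-v) = 1 := by
  have := isProbabilityMeasure_unif hn
  rw [disagree, measureReal_congr (t := univ), probReal_univ]
  rw [ae_eq_univ, compl_ofPred, ← nonpos_iff_eq_zero]
  refine le_trans (measure_mono ?_) (nonpos_iff_eq_zero.2 (unif_inner_eq_zero v))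
  intro t ht
  by_contra h0
  simp only [mem_ofPred_eq, not_not] at ht h0
  rw [real_inner_comm] at h0
  have hneg : ⟪((-v : Sph n) : E n), (t : E n)⟫ = -⟪(v : E n), (t : E n)⟫ := by simp
  rw [hneg, sgn_eq_sgn_iff s₀ h0 (neg_ne_zero.2 h0)] at ht
  rcases lt_or_gt_of_ne h0 with h | h
  · exact absurd (ht.2 (by linarith)) (by linarith)
  · exact absurd (ht.1 h) (by linarith)

section DisagreeArc

variable {n : ℕ} {e f : Sph n} (hef : ⟪(e : E n), (f : E n)⟫ = 0)

theorem disagree_arc_shift (s₀ : ℤˣ) (a s t : ℝ) :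
    disagree s₀ (arc e f hef s) (arc e f hef t) =
      disagree s₀ (arc e f hef a) (arc e f hef (a + t - s)) := by
  -- The angle is chosen so that t goes to a and s to a + t - s; the symmetry of `disagree` undoes
  -- the swap.
  rw [← disagree_act s₀ (refl (arc e f hef ((a + t - Real.pi) / 2))), refl_arc, refl_arc,
    disagree_comm]
  congr 2 <;> ring

/-- The middle normal is a nonnegative combination of the outer ones, so where the outer signs agree
the middle one agrees too. Up to null sets, the disagreement sets of the two subarcs are therefore
disjoint with union that of the whole arc. -/
theorem disagree_arc_add (s₀ : ℤˣ) {a b : ℝ} (ha : 0 ≤ a) (hb : 0 ≤ b) (hab : a + b ≤ Real.pi) :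
    disagree s₀ (arc e f hef 0) (arc e f hef (a + b)) =
      disagree s₀ (arc e f hef 0) (arc e f hef a) + disagree s₀ (arc e f hef 0) (arc e f hef b) := by
  rw [disagree_arc_shift hef s₀ a 0 b, sub_zero]
  have key : ∀ t : Sph n, Real.sin (a + b) * ⟪(arc e f hef a : E n), (t : E n)⟫ =
      Real.sin b * ⟪(arc e f hef 0 : E n), (t : E n)⟫ +
        Real.sin a * ⟪(arc e f hef (a + b) : E n), (t : E n)⟫ := by
    intro t
    rw [inner_arc_left, inner_arc_left, inner_arc_left]
    have h1 : Real.sin (a + b) * Real.cos a = Real.sin b + Real.sin a * Real.cos (a + b) := by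
      have : Real.sin b = Real.sin (a + b - a) := by ring_nf
      rw [this, Real.sin_sub (a + b) a]
      ring
    rw [Real.cos_zero, Real.sin_zero]
    linear_combination ⟪(e : E n), (t : E n)⟫ * h1
  have hsa : 0 ≤ Real.sin a := Real.sin_nonneg_of_nonneg_of_le_pi ha (by linarith)
  have hsb : 0 ≤ Real.sin b := Real.sin_nonneg_of_nonneg_of_le_pi hb (by linarith)
  have hsab : 0 ≤ Real.sin (a + b) := Real.sin_nonneg_of_nonneg_of_le_pi (by linarith) hab
  have same : ∀ t : Sph n, ⟪(arc e f hef 0 : E n), (t : E n)⟫ ≠ 0 →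
      ⟪(arc e f hef a : E n), (t : E n)⟫ ≠ 0 → ⟪(arc e f hef (a + b) : E n), (t : E n)⟫ ≠ 0 →
      (0 < ⟪(arc e f hef 0 : E n), (t : E n)⟫ ↔ 0 < ⟪(arc e f hef (a + b) : E n), (t : E n)⟫) →
      (0 < ⟪(arc e f hef 0 : E n), (t : E n)⟫ ↔ 0 < ⟪(arc e f hef a : E n), (t : E n)⟫) := by
    intro t h0 ha0 hab0 h
    -- If the sine vanishes, either the ends are antipodal and cannot agree, or the arc is a point.
    rcases hsab.eq_or_lt with hz | hpos
    · rcases hab.eq_or_lt with hpi | hlt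
      · exfalso
        have : (arc e f hef (a + b)) = -arc e f hef 0 := by
          rw [← arc_add_pi, hpi, zero_add]
        rw [this, coe_neg_sphere, inner_neg_left] at h
        rcases lt_or_gt_of_ne h0 with h' | h'
        · exact absurd (h.2 (by linarith)) (by linarith)
        · exact absurd (h.1 h') (by linarith)
      · have : a + b = 0 := by
          by_contra hne
          exact absurd (Real.sin_pos_of_pos_of_lt_pi
            (lt_of_le_of_ne (by linarith) (Ne.symm hne)) hlt) (by linarith)
        have ha' : a = 0 := by linarith
        rw [ha']
    · have hk := key t
      rcases lt_or_gt_of_ne h0 with h' | h'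
      · have h2 : ⟪(arc e f hef (a + b) : E n), (t : E n)⟫ < 0 :=
          lt_of_le_of_ne (not_lt.1 fun hh => absurd (h.2 hh) (by linarith)) hab0
        have h3 : ¬ 0 < ⟪(arc e f hef a : E n), (t : E n)⟫ := fun hh => by
          have := mul_pos hpos hh
          have := mul_nonpos_of_nonneg_of_nonpos hsb h'.le
          have := mul_nonpos_of_nonneg_of_nonpos hsa h2.le
          linarith
        exact iff_of_false (by linarith) h3
      · have h2 := h.1 h'
        refine iff_of_true h' (lt_of_le_of_ne (not_lt.1 fun hh => ?_) ha0.symm)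
        have := mul_neg_of_pos_of_neg hpos hh
        have := mul_nonneg hsb h'.le
        have := mul_nonneg hsa h2.le
        linarith
  simp only [disagree]
  set A := {t : Sph n | sgn s₀ ⟪(arc e f hef 0 : E n), (t : E n)⟫ ≠
    sgn s₀ ⟪(arc e f hef a : E n), (t : E n)⟫}
  set B := {t : Sph n | sgn s₀ ⟪(arc e f hef a : E n), (t : E n)⟫ ≠
    sgn s₀ ⟪(arc e f hef (a + b) : E n), (t : E n)⟫}
  have hB : MeasurableSet B := measurableSet_disagree s₀ _ _
  have hnull := (ae_inner_ne_zero' (arc e f hef 0)).and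
    ((ae_inner_ne_zero' (arc e f hef a)).and (ae_inner_ne_zero' (arc e f hef (a + b))))
  have hdisj : AEDisjoint (unif n) A B := by
    rw [AEDisjoint, ← ae_eq_empty, eventuallyEq_empty]
    filter_upwards [hnull] with t ⟨h0, h1, h2⟩ ⟨hA, hB⟩
    simp only [A, B, mem_ofPred_eq, ne_eq, sgn_eq_sgn_iff s₀ h0 h1, sgn_eq_sgn_iff s₀ h1 h2]
      at hA hB
    have := same t h0 h1 h2
    tauto
  rw [measureReal_congr (t := A ∪ B)]
  · rw [Measure.real, measure_union₀ hB.nullMeasurableSet hdisj,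
      ENNReal.toReal_add (measure_ne_top _ _) (measure_ne_top _ _)]
    rfl
  · refine eventuallyEq_set.2 ?_
    filter_upwards [hnull] with t ⟨h0, h1, h2⟩
    simp only [A, B, mem_ofPred_eq, mem_union, ne_eq, sgn_eq_sgn_iff s₀ h0 h1,
      sgn_eq_sgn_iff s₀ h1 h2, sgn_eq_sgn_iff s₀ h0 h2]
    have := same t h0 h1 h2
    tauto

/-- An additive nonnegative function on `[0, c]` is linear. -/
theorem eq_div_mul_of_additive {F : ℝ → ℝ} {c : ℝ} (hc : 0 < c) (hF : ∀ t, 0 ≤ F t)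
    (hadd : ∀ a b, 0 ≤ a → 0 ≤ b → a + b ≤ c → F (a + b) = F a + F b)
    {t : ℝ} (ht0 : 0 ≤ t) (htc : t ≤ c) : F t = t / c * F c := by
  have hmul : ∀ (k : ℕ) (s : ℝ), 0 ≤ s → k * s ≤ c → F (k * s) = k * F s := by
    intro k s hs
    induction k with
    | zero =>
      intro _
      have := hadd 0 0 le_rfl le_rfl (by linarith)
      simp only [Nat.cast_zero, zero_mul]
      rw [add_zero] at this
      linarith
    | succ k ih =>
      intro hk
      push_cast at hk ⊢
      have hks : (0 : ℝ) ≤ k * s := by positivity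
      rw [show ((k : ℝ) + 1) * s = k * s + s by ring,
        hadd _ _ hks hs (by linarith), ih (by linarith)]
      ring
  have hmono : ∀ a b, 0 ≤ a → a ≤ b → b ≤ c → F a ≤ F b := by
    intro a b h1 h2 h3
    have := hadd a (b - a) h1 (by linarith) (by linarith)
    rw [add_sub_cancel] at this
    linarith [hF (b - a)]
  -- With s = c/N and k = ⌊t/s⌋, both values lie between k F(s) and (k + 1) F(s), and F(s) = F(c)/N.
  have hb : ∀ N : ℕ, 0 < N → |F t - t / c * F c| ≤ F c / N := by
    intro N hN
    have hN' : (0 : ℝ) < N := by exact_mod_cast hN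
    set s := c / N with hs
    have hspos : 0 < s := div_pos hc hN'
    have hNs : N * s = c := by rw [hs]; field_simp
    have hFc : F c = N * F s := by rw [← hmul N s hspos.le hNs.le, hNs]
    have hts : t / c * F c = t / s * F s := by
      rw [hFc, ← hNs]; field_simp
    have hFN : F c / N = F s := by rw [hFc]; field_simp
    rw [hts, hFN]
    set k := ⌊t / s⌋₊
    have hk1 : (k : ℝ) ≤ t / s := Nat.floor_le (by positivity)
    have hk2 : t / s < k + 1 := Nat.lt_floor_add_one _
    have hk1' : k * s ≤ t := (le_div_iff₀ hspos).1 hk1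
    have hk2' : t < (k + 1) * s := (div_lt_iff₀ hspos).1 hk2
    have e1 : F (k * s) = k * F s := hmul k s hspos.le (by linarith)
    have l1 : k * F s ≤ F t := e1 ▸ hmono _ _ (by positivity) hk1' htc
    have l2 : F t ≤ (k + 1) * F s := by
      have e2 := hadd (k * s) (t - k * s) (by positivity) (by linarith) (by linarith)
      rw [add_sub_cancel] at e2
      rcases le_total s c with hsc | hsc
      · have := hmono (t - k * s) s (by linarith) (by linarith) hsc
        linarith
      · have := hmono (t - k * s) c (by linarith)
          (by linarith [mul_nonneg k.cast_nonneg hspos.le]) le_rfl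
        have hcs : F c ≤ F s := by
          have h1N : (1 : ℝ) ≤ N := by exact_mod_cast hN
          have : s ≤ c := by rw [hs]; exact div_le_self hc.le h1N
          rw [le_antisymm this hsc]
        linarith
    have hFs := hF s
    have l3 : k * F s ≤ t / s * F s := mul_le_mul_of_nonneg_right hk1 hFs
    have l4 : t / s * F s ≤ (k + 1) * F s := mul_le_mul_of_nonneg_right hk2.le hFs
    rw [abs_le]
    constructor <;> linarith
  have hlim : Tendsto (fun N : ℕ => F c / N) atTop (𝓝 0) := tendsto_const_div_atTop_nhds_zero_nat _
  have : |F t - t / c * F c| ≤ 0 :=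
    ge_of_tendsto hlim ((eventually_gt_atTop 0).mono hb)
  have := abs_nonpos_iff.1 this
  linarith

theorem disagree_eq_geo_div_pi (hn : 1 ≤ n) (s₀ : ℤˣ) (v u : Sph n) :
    disagree s₀ v u = geo v u / Real.pi := by
  by_cases h0 : v = u
  · rw [h0, disagree_self, geo_self, zero_div]
  by_cases h1 : u = -v
  · rw [h1, disagree_neg hn, geo_comm, geo_neg_left, geo_self, sub_zero, div_self Real.pi_ne_zero]
  obtain ⟨f, hf, hu⟩ := exists_arc_eq h0 h1
  have := eq_div_mul_of_additive Real.pi_pos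
    (F := fun t => disagree s₀ (arc v f hf 0) (arc v f hf t)) (fun t => disagree_nonneg _ _ _)
    (fun a b ha hb hab => disagree_arc_add hf s₀ ha hb hab) (geo_nonneg v u) (geo_le_pi v u)
  rw [← hu, ← zero_add Real.pi, arc_add_pi, disagree_neg hn, arc_zero, zero_add, mul_one] at this
  exact this

end DisagreeArc

/-! ### Folding along a reflection -/

theorem integrable_of_continuous {n : ℕ} {D : Sph n → ℝ} (hD : Continuous D) :
    Integrable D (unif n) :=
  hD.integrable_of_hasCompactSupport (HasCompactSupport.of_compactSpace _)

theorem continuous_geo_right {n : ℕ} (w : Sph n) : Continuous fun u => geo w u := by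
  simp only [geo_eq_arccos]
  fun_prop

section Fold

variable {n : ℕ} {b : Sph n} {κ : Set (Sph n)} {D : Sph n → ℝ}

/-- If u and its mirror image both lie in κ, they cancel; a point of κ whose image is outside κ must
lie in the hemisphere of b. -/
theorem fold_nonneg (hfold : ∀ u ∈ κ, ⟪(u : E n), (b : E n)⟫ ≤ 0 → act (refl b) u ∈ κ)
    (hanti : ∀ u, D (act (refl b) u) = -D u)
    (hpos : ∀ u : Sph n, 0 ≤ ⟪(u : E n), (b : E n)⟫ → 0 ≤ D u) (u : Sph n) :
    0 ≤ κ.indicator D u + κ.indicator D (act (refl b) u) := by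
  by_cases h1 : u ∈ κ <;> by_cases h2 : act (refl b) u ∈ κ
  · rw [indicator_of_mem h1, indicator_of_mem h2, hanti, add_neg_cancel]
  · rw [indicator_of_mem h1, indicator_of_notMem h2, add_zero]
    exact hpos u (not_lt.1 fun h => h2 (hfold u h1 h.le))
  · rw [indicator_of_notMem h1, indicator_of_mem h2, zero_add]
    refine hpos _ (not_lt.1 fun h => h1 ?_)
    have := hfold _ h2 h.le
    rwa [act_refl_act_refl] at this
  · rw [indicator_of_notMem h1, indicator_of_notMem h2, add_zero]

theorem integrable_fold (hκ : MeasurableSet κ) (hD : Continuous D) :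
    Integrable (fun u => κ.indicator D u + κ.indicator D (act (refl b) u)) (unif n) :=
  ((integrable_of_continuous hD).indicator hκ).add
    ((measurePreserving_act (refl b)).integrable_comp_of_integrable
      ((integrable_of_continuous hD).indicator hκ))

theorem integral_fold (hκ : MeasurableSet κ) (hD : Continuous D) :
    ∫ u, (κ.indicator D u + κ.indicator D (act (refl b) u)) ∂(unif n) =
      2 * ∫ u in κ, D u ∂(unif n) := by
  have hi := (integrable_of_continuous hD).indicator hκ
  have hi' : Integrable (fun u => κ.indicator D (act (refl b) u)) (unif n) :=
    (measurePreserving_act (refl b)).integrable_comp_of_integrable hi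
  rw [integral_add hi hi',
    (measurePreserving_act (refl b)).integral_comp (measurableEmbedding_act _) (κ.indicator D),
    integral_indicator hκ]
  ring

theorem setIntegral_nonneg_of_fold (hκ : MeasurableSet κ) (hD : Continuous D)
    (hfold : ∀ u ∈ κ, ⟪(u : E n), (b : E n)⟫ ≤ 0 → act (refl b) u ∈ κ)
    (hanti : ∀ u, D (act (refl b) u) = -D u)
    (hpos : ∀ u : Sph n, 0 ≤ ⟪(u : E n), (b : E n)⟫ → 0 ≤ D u) :
    0 ≤ ∫ u in κ, D u ∂(unif n) := by
  have := integral_nonneg (μ := unif n)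
    (f := fun u => κ.indicator D u + κ.indicator D (act (refl b) u))
    fun u => fold_nonneg hfold hanti hpos u
  rw [integral_fold hκ hD] at this
  linarith

/-- On U nothing cancels, and nonempty open sets have positive measure. -/
theorem setIntegral_pos_of_fold (hκ : MeasurableSet κ) (hD : Continuous D)
    (hfold : ∀ u ∈ κ, ⟪(u : E n), (b : E n)⟫ ≤ 0 → act (refl b) u ∈ κ)
    (hanti : ∀ u, D (act (refl b) u) = -D u)
    (hpos : ∀ u : Sph n, 0 ≤ ⟪(u : E n), (b : E n)⟫ → 0 ≤ D u)
    {U : Set (Sph n)} (hU : IsOpen U) (hUne : U.Nonempty) (hUκ : U ⊆ κ)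
    (hUb : ∀ u ∈ U, act (refl b) u ∉ κ) (hUD : ∀ u ∈ U, 0 < D u) :
    0 < ∫ u in κ, D u ∂(unif n) := by
  have := (integral_pos_iff_support_of_nonneg (μ := unif n)
    (f := fun u => κ.indicator D u + κ.indicator D (act (refl b) u))
    (fun u => fold_nonneg hfold hanti hpos u) (integrable_fold (b := b) hκ hD)).2
      ((hU.measure_pos (unif n) hUne).trans_le (measure_mono fun u hu => ?_))
  · rw [integral_fold hκ hD] at this
    linarith
  · rw [Function.mem_support, indicator_of_mem (hUκ hu), indicator_of_notMem (hUb u hu), add_zero]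
    exact (hUD u hu).ne'

end Fold

/-! ### Version-space cones -/

/-- The interior of the version-space cone. -/
def openCone {n m : ℕ} (x : Fin m → Sph n) (y : Fin m → ℤˣ) : Set (E n) :=
  {v | ∀ i, 0 < ⟪v, signed x y i⟫}

section Cone

variable {n m : ℕ} {x : Fin m → Sph n} {y : Fin m → ℤˣ}

theorem openCone_subset_cone : openCone x y ⊆ cone x y := fun _ hv i => (hv i).le

theorem isOpen_openCone : IsOpen (openCone x y) := by
  rw [openCone, ofPred_forall]
  exact isOpen_iInter_of_finite fun i => isOpen_lt continuous_const (by fun_prop)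

theorem isClosed_cone : IsClosed (cone x y) := by
  rw [cone, ofPred_forall]
  exact isClosed_iInter fun i => isClosed_le continuous_const (by fun_prop)

theorem norm_signed (i : Fin m) : ‖signed x y i‖ = 1 := by
  rcases Int.units_eq_one_or (y i) with h | h <;> simp [signed, h]

theorem inner_signed_eq_zero_iff (v : E n) (i : Fin m) :
    ⟪v, signed x y i⟫ = 0 ↔ ⟪v, (x i : E n)⟫ = 0 := by
  rcases Int.units_eq_one_or (y i) with h | h <;> simp [signed, h]

theorem interior_cone : interior (cone x y) = openCone x y := by
  apply Subset.antisymm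
  · intro v hv i
    refine lt_of_le_of_ne (interior_subset hv i) fun h => ?_
    -- On a bounding hyperplane, a small move against the constraint normal leaves the cone.
    have hc : Tendsto (fun t : ℝ => v - t • signed x y i) (𝓝 0) (𝓝 (v - (0 : ℝ) • signed x y i)) :=
      Continuous.tendsto (by fun_prop) 0
    rw [zero_smul, sub_zero] at hc
    have hev := hc.eventually (isOpen_interior.mem_nhds hv)
    obtain ⟨t, ht, htpos⟩ :=
      ((hev.filter_mono nhdsWithin_le_nhds).and (self_mem_nhdsWithin : Ioi (0 : ℝ) ∈ 𝓝[>] 0)).exists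
    have := interior_subset ht i
    rw [inner_sub_left, ← h, inner_smul_left, real_inner_self_eq_norm_sq, norm_signed] at this
    simp only [conj_trivial] at this htpos
    linarith
  · exact interior_maximal openCone_subset_cone isOpen_openCone

theorem add_mem_cone {u v : E n} (hu : u ∈ cone x y) (hv : v ∈ cone x y) : u + v ∈ cone x y :=
  fun i => by rw [inner_add_left]; exact add_nonneg (hu i) (hv i)

theorem smul_mem_cone {c : ℝ} (hc : 0 ≤ c) {v : E n} (hv : v ∈ cone x y) : c • v ∈ cone x y :=
  fun i => by rw [inner_smul_left]; exact mul_nonneg hc (hv i)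

theorem add_mem_openCone {u v : E n} (hu : u ∈ openCone x y) (hv : v ∈ openCone x y) :
    u + v ∈ openCone x y :=
  fun i => by rw [inner_add_left]; exact add_pos (hu i) (hv i)

theorem smul_mem_openCone {c : ℝ} (hc : 0 < c) {v : E n} (hv : v ∈ openCone x y) :
    c • v ∈ openCone x y :=
  fun i => by rw [inner_smul_left]; exact mul_pos hc (hv i)

/-- One example is needed: without constraints the cone is the whole space. -/
theorem neg_notMem_cone (hm : 1 ≤ m) {v : E n} (hv : v ∈ openCone x y) : -v ∉ cone x y := by
  intro h
  have h1 := h ⟨0, hm⟩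
  have h2 := hv ⟨0, hm⟩
  rw [inner_neg_left] at h1
  linarith

/-- The trace of the version-space cone on the sphere. -/
def sphCone (x : Fin m → Sph n) (y : Fin m → ℤˣ) : Set (Sph n) := {u | (u : E n) ∈ cone x y}

/-- The trace of the open version-space cone on the sphere. -/
def sphOpenCone (x : Fin m → Sph n) (y : Fin m → ℤˣ) : Set (Sph n) :=
  {u | (u : E n) ∈ openCone x y}

theorem isOpen_sphOpenCone : IsOpen (sphOpenCone x y) :=
  isOpen_openCone.preimage continuous_subtype_val

theorem isClosed_sphCone : IsClosed (sphCone x y) := isClosed_cone.preimage continuous_subtype_val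

/-- All boundary points lie in the finitely many null subspheres orthogonal to some x i, whatever y
is. -/
theorem ae_sphCone_iff (x : Fin m → Sph n) :
    ∀ᵐ u : Sph n ∂(unif n), ∀ y, u ∈ sphCone x y ↔ u ∈ sphOpenCone x y := by
  filter_upwards [ae_all_iff.2 fun i => ae_inner_ne_zero (x i)] with u hu y
  exact ⟨fun h i => lt_of_le_of_ne (h i) fun h0 => hu i ((inner_signed_eq_zero_iff _ i).1 h0.symm),
    fun h => openCone_subset_cone h⟩

theorem psi_cone_eq (w : Sph n) :
    psi (cone x y) w = ∫ u in sphOpenCone x y, geo w u ∂(unif n) :=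
  setIntegral_congr_set (eventuallyEq_set.2 ((ae_sphCone_iff x).mono fun _ hu => hu y))

theorem psi_eq_zero_of_interior_empty (h : ¬ (interior (cone x y)).Nonempty) (w : Sph n) :
    psi (cone x y) w = 0 := by
  rw [interior_cone, not_nonempty_iff_eq_empty] at h
  have : sphOpenCone x y = ∅ := by
    ext u; simp [sphOpenCone, h]
  rw [psi_cone_eq, this, setIntegral_empty]

theorem sphOpenCone_nonempty (hm : 1 ≤ m) (h : (openCone x y).Nonempty) :
    (sphOpenCone x y).Nonempty := by
  obtain ⟨v, hv⟩ := h
  have hv0 : v ≠ 0 := by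
    rintro rfl
    simpa using hv ⟨0, hm⟩
  refine ⟨⟨‖v‖⁻¹ • v, ?_⟩, smul_mem_openCone (by positivity) hv⟩
  rw [mem_sphere_zero_iff_norm, norm_smul, norm_inv, norm_norm,
    inv_mul_cancel₀ (norm_ne_zero_iff.2 hv0)]

/-- The reflection adds to u a nonnegative multiple of b, so the convex cone is not left. -/
theorem act_refl_mem_sphCone {b u : Sph n} (hb : b ∈ sphCone x y) (hu : u ∈ sphCone x y)
    (h : ⟪(u : E n), (b : E n)⟫ ≤ 0) : act (refl b) u ∈ sphCone x y := by
  change refl b u ∈ cone x y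
  rw [refl_apply, sub_eq_add_neg, ← neg_smul]
  refine add_mem_cone hu (smul_mem_cone ?_ hb)
  rw [real_inner_comm]
  linarith

theorem psi_neg (w : Sph n) :
    psi (cone x y) (-w) = Real.pi * (unif n).real (sphCone x y) - psi (cone x y) w := by
  have hi := (integrable_of_continuous (continuous_geo_right w)).integrableOn (s := sphCone x y)
  change ∫ u in sphCone x y, geo (-w) u ∂(unif n) = _ - ∫ u in sphCone x y, geo w u ∂(unif n)
  simp only [geo_neg_left]
  rw [integral_sub (integrable_const _) hi]
  simp [mul_comm]

end Cone

/-! ### Strict midpoint convexity -/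

section Midpoint

variable {n m : ℕ} {x : Fin m → Sph n} {y : Fin m → ℤˣ} {e f : Sph n}
  (hef : ⟪(e : E n), (f : E n)⟫ = 0)

theorem geo_arc {s t : ℝ} (h : |s - t| ≤ Real.pi) :
    geo (arc e f hef s) (arc e f hef t) = |s - t| := by
  rw [geo_eq_arccos, inner_arc_arc, ← Real.cos_abs, Real.arccos_cos (abs_nonneg _) h]

theorem geo_act_refl {b p u : Sph n} : geo p (act (refl b) u) = geo (act (refl b) p) u := by
  rw [← geo_act_act (refl b), act_refl_act_refl]

/-- With α, β the outer distances and ρ the middle one, cos α + cos β = 2 cos h cos ρ, while |α - β|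
≤ 2h gives cos h ≤ cos((α - β)/2). If (α + β)/2 < ρ, the sum-to-product formula would make the left
side too large. -/
theorem two_mul_geo_arc_le {s h : ℝ} (h0 : 0 < h) (h1 : h < Real.pi / 2) {u : Sph n}
    (hu : 0 ≤ ⟪(u : E n), (arc e f hef s : E n)⟫) :
    2 * geo (arc e f hef s) u ≤ geo (arc e f hef (s - h)) u + geo (arc e f hef (s + h)) u := by
  set α := geo (arc e f hef (s - h)) u with hα
  set β := geo (arc e f hef (s + h)) u with hβ
  set ρ := geo (arc e f hef s) u with hρ
  have hcos : Real.cos α + Real.cos β = 2 * Real.cos h * Real.cos ρ := by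
    rw [hα, hβ, hρ, cos_geo, cos_geo, cos_geo, inner_arc_left, inner_arc_left, inner_arc_left,
      Real.cos_sub, Real.cos_add, Real.sin_sub, Real.sin_add]
    ring
  have hρ0 : 0 ≤ Real.cos ρ := by rw [hρ, cos_geo, real_inner_comm]; exact hu
  have hd : |α - β| ≤ 2 * h := by
    refine (abs_geo_sub_le _ _ _).trans ((geo_arc_le hef _ _).trans_eq ?_)
    rw [show s - h - (s + h) = -(2 * h) by ring, abs_neg, abs_of_pos (by linarith)]
  by_contra hlt
  have hlt' : (α + β) / 2 < ρ := by linarith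
  have hα0 : 0 ≤ α := geo_nonneg _ _
  have hβ0 : 0 ≤ β := geo_nonneg _ _
  have hρpi : ρ ≤ Real.pi := geo_le_pi _ _
  have c1 : Real.cos ρ < Real.cos ((α + β) / 2) :=
    Real.cos_lt_cos_of_nonneg_of_le_pi (by linarith) hρpi hlt'
  have c2 : Real.cos h ≤ Real.cos ((α - β) / 2) := by
    rw [← Real.cos_abs ((α - β) / 2)]
    refine Real.cos_le_cos_of_nonneg_of_le_pi (abs_nonneg _) (by linarith [Real.pi_pos]) ?_
    rw [abs_div, abs_two]
    linarith
  have c3 : 0 < Real.cos h := Real.cos_pos_of_mem_Ioo ⟨by linarith, h1⟩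
  have c4 : Real.cos α + Real.cos β =
      2 * Real.cos ((α + β) / 2) * Real.cos ((α - β) / 2) := Real.cos_add_cos α β
  nlinarith [mul_le_mul_of_nonneg_left c2 (hρ0.trans c1.le), mul_lt_mul_of_pos_right c1 c3]

/-- Fold along w, the midpoint. The reflection sends p to -q, q to -p and w to -w, so the second
difference of distances is odd. -/
theorem psi_midpoint_lt (hm : 1 ≤ m) {s h : ℝ} (h0 : 0 < h) (h1 : h < Real.pi / 2)
    (hs : arc e f hef s ∈ sphOpenCone x y) :
    2 * psi (cone x y) (arc e f hef s) <
      psi (cone x y) (arc e f hef (s - h)) + psi (cone x y) (arc e f hef (s + h)) := by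
  set w := arc e f hef s with hw
  set p := arc e f hef (s - h) with hp
  set q := arc e f hef (s + h) with hq
  have hRp : act (refl w) p = -q := by
    rw [hp, hq, hw, refl_arc, ← arc_add_pi]; ring_nf
  have hRq : act (refl w) q = -p := by
    rw [hp, hq, hw, refl_arc, ← arc_add_pi]; ring_nf
  have hRw : act (refl w) w = -w := by
    rw [hw, refl_arc, ← arc_add_pi]; ring_nf
  have hDc : Continuous fun u => geo p u + geo q u - 2 * geo w u :=
    ((continuous_geo_right p).add (continuous_geo_right q)).sub
      (continuous_const.mul (continuous_geo_right w))
  have hws : w ∈ sphCone x y := openCone_subset_cone hs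
  have hpw : geo p w = h := by
    rw [hp, hw, geo_arc] <;> rw [show s - h - s = -h by ring, abs_neg, abs_of_pos h0]
    linarith [Real.pi_pos]
  -- Strictness comes from w itself: it lies in U because -w is outside the cone and the integrand
  -- at w is at least h.
  have key := setIntegral_pos_of_fold (b := w) (κ := sphCone x y) (n := n)
    (U := sphOpenCone x y ∩ (act (refl w) ⁻¹' (sphCone x y)ᶜ ∩
      {u | 0 < geo p u + geo q u - 2 * geo w u}))
    isClosed_sphCone.measurableSet hDc
    (fun u hu h => act_refl_mem_sphCone hws hu h)
    (fun u => by
      simp only [geo_act_refl, hRp, hRq, hRw, geo_neg_left]; ring)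
    (fun u hu => by linarith [two_mul_geo_arc_le hef h0 h1 hu])
    (isOpen_sphOpenCone.inter ((isClosed_sphCone.isOpen_compl.preimage (continuous_act _)).inter
      (isOpen_lt continuous_const hDc)))
    ⟨w, hs, by
      rw [mem_preimage, hRw]
      exact neg_notMem_cone hm hs, by
      have := geo_nonneg q w
      simp only [mem_ofPred_eq, geo_self, hpw]
      linarith⟩
    (fun u hu => openCone_subset_cone hu.1) (fun u hu => hu.2.1) (fun u hu => hu.2.2)
  have hi : ∀ v : Sph n, Integrable (fun u => geo v u) ((unif n).restrict (sphCone x y)) :=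
    fun v => (integrable_of_continuous (continuous_geo_right v)).integrableOn
  have hpq : Integrable (fun u => geo p u + geo q u) ((unif n).restrict (sphCone x y)) :=
    (hi p).add (hi q)
  rw [integral_sub hpq ((hi w).const_mul 2), integral_add (hi p) (hi q),
    integral_const_mul] at key
  change 0 < psi (cone x y) p + psi (cone x y) q - 2 * psi (cone x y) w at key
  linarith

end Midpoint

/-! ### Minimizers of `ψ` -/

section Minimizers

variable {n m : ℕ} {x : Fin m → Sph n} {y : Fin m → ℤˣ}

theorem abs_psi_sub_le (K : Set (E n)) (v w : Sph n) :
    |psi K v - psi K w| ≤ geo v w * (unif n).real {u : Sph n | (u : E n) ∈ K} := by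
  have hi : ∀ v : Sph n, Integrable (fun u => geo v u)
      ((unif n).restrict {u : Sph n | (u : E n) ∈ K}) :=
    fun v => (integrable_of_continuous (continuous_geo_right v)).integrableOn
  rw [psi, psi, ← integral_sub (hi v) (hi w), ← Real.norm_eq_abs]
  refine norm_setIntegral_le_of_norm_le_const (measure_lt_top _ _) fun u _ => ?_
  exact abs_geo_sub_le v w u

theorem continuous_psi (K : Set (E n)) : Continuous (psi K) := by
  rw [continuous_iff_continuousAt]
  intro w
  rw [ContinuousAt, tendsto_iff_norm_sub_tendsto_zero]
  have hg : Tendsto (fun v : Sph n => geo v w * (unif n).real {u : Sph n | (u : E n) ∈ K})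
      (𝓝 w) (𝓝 0) := by
    have h : Continuous fun v : Sph n =>
        geo v w * (unif n).real {u : Sph n | (u : E n) ∈ K} := by
      simp only [geo_comm _ w]
      exact (continuous_geo_right w).mul continuous_const
    have := h.tendsto w
    rwa [geo_self, zero_mul] at this
  exact squeeze_zero (fun _ => norm_nonneg _) (fun v => abs_psi_sub_le K v w) hg

theorem eventually_arc {e f : Sph n} (hef : ⟪(e : E n), (f : E n)⟫ = 0) {P : Sph n → Prop}
    (h : ∀ᶠ v in 𝓝 e, P v) : ∀ᶠ t in 𝓝 (0 : ℝ), P (arc e f hef t) := by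
  have hc := (continuous_arc hef).tendsto 0
  rw [arc_zero] at hc
  exact hc.eventually h

/-- Spherical interpolation writes the point as a positive combination of the two ends. -/
theorem arc_mem_sphOpenCone {e f : Sph n} {hef : ⟪(e : E n), (f : E n)⟫ = 0} {T t : ℝ}
    (hT : T < Real.pi) (h0 : e ∈ sphOpenCone x y) (h1 : arc e f hef T ∈ sphOpenCone x y)
    (ht0 : 0 < t) (htT : t < T) : arc e f hef t ∈ sphOpenCone x y := by
  have hsT : 0 < Real.sin T := Real.sin_pos_of_pos_of_lt_pi (ht0.trans htT) hT
  have hst : 0 < Real.sin t := Real.sin_pos_of_pos_of_lt_pi ht0 (htT.trans hT)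
  have hsTt : 0 < Real.sin (T - t) := Real.sin_pos_of_pos_of_lt_pi (by linarith) (by linarith)
  have : (arc e f hef t : E n) =
      (Real.sin T)⁻¹ • (Real.sin (T - t) • (e : E n) + Real.sin t • (arc e f hef T : E n)) := by
    rw [eq_inv_smul_iff₀ hsT.ne', coe_arc, coe_arc, Real.sin_sub]
    module
  change (arc e f hef t : E n) ∈ openCone x y
  rw [this]
  exact smul_mem_openCone (inv_pos.2 hsT)
    (add_mem_openCone (smul_mem_openCone hsTt h0) (smul_mem_openCone hst h1))

/-- Strict midpoint convexity forbids a maximum of ψ inside the arc from v to w. The maximum is thus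
at v, since ψ(w) ≤ ψ(v); but the local minimum at v makes nearby points of the arc maximal as well.
-/
theorem eq_of_isLocalMin_of_isMin (hm : 1 ≤ m) {v w : Sph n} (hv : v ∈ sphOpenCone x y)
    (hw : w ∈ sphOpenCone x y) (hloc : IsLocalMin (psi (cone x y)) v)
    (hmin : ∀ w', psi (cone x y) w ≤ psi (cone x y) w') : v = w := by
  by_contra hne
  have hneg : w ≠ -v := fun h => neg_notMem_cone hm hv (by
    have := openCone_subset_cone hw
    rwa [h] at this)
  obtain ⟨f, hef, hwa⟩ := exists_arc_eq hne hneg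
  set T := geo v w with hT
  have hT0 : 0 < T := lt_of_le_of_ne (geo_nonneg v w) fun h => hne (eq_of_geo_eq_zero h.symm)
  have hTpi : T < Real.pi :=
    lt_of_le_of_ne (geo_le_pi v w) fun h => hneg (eq_neg_of_geo_eq_pi h)
  set φ : ℝ → ℝ := fun t => psi (cone x y) (arc v f hef t) with hφ
  have hφc : Continuous φ := (continuous_psi _).comp (continuous_arc hef)
  have hint : ∀ t, 0 < t → t < T → ¬ ∀ s ∈ Icc 0 T, φ s ≤ φ t := by
    intro t h0 h1 hmax
    have hpi := Real.pi_pos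
    -- This step keeps t ± h inside [0, T] and h below π/2.
    have hh : 0 < min (min t (T - t)) 1 := lt_min (lt_min h0 (by linarith)) one_pos
    have hl1 : min (min t (T - t)) 1 ≤ t := (min_le_left _ _).trans (min_le_left _ _)
    have hl2 : min (min t (T - t)) 1 ≤ T - t := (min_le_left _ _).trans (min_le_right _ _)
    have hl3 : min (min t (T - t)) 1 ≤ 1 := min_le_right _ _
    set h := min (min t (T - t)) 1
    have := psi_midpoint_lt (x := x) (y := y) hef hm hh (by linarith [Real.pi_gt_three])
      (arc_mem_sphOpenCone hTpi hv (hwa ▸ hw) h0 h1)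
    have m1 := hmax (t - h) ⟨by linarith, by linarith⟩
    have m2 := hmax (t + h) ⟨by linarith, by linarith⟩
    simp only [hφ] at m1 m2
    linarith
  obtain ⟨t₀, ht₀, hmax⟩ := isCompact_Icc.exists_isMaxOn (nonempty_Icc.2 hT0.le)
    hφc.continuousOn
  have hφT : φ T ≤ φ 0 := by
    simp only [hφ]
    rw [← hwa]
    exact hmin _
  have hmax0 : ∀ s ∈ Icc 0 T, φ s ≤ φ 0 := by
    intro s hs
    refine (hmax hs).trans ?_
    rcases ht₀.1.eq_or_lt with h | h
    · rw [← h]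
    rcases ht₀.2.eq_or_lt with h' | h'
    · rw [h']; exact hφT
    · exact absurd (fun s hs => hmax hs) (hint t₀ h h')
  have hev : ∀ᶠ t in 𝓝 (0 : ℝ), φ 0 ≤ φ t := by
    simp only [hφ, arc_zero]
    exact eventually_arc hef hloc
  obtain ⟨t, ht, ht0, htT⟩ := ((hev.filter_mono nhdsWithin_le_nhds).and
    (Ioo_mem_nhdsGT hT0 : Ioo 0 T ∈ 𝓝[>] (0 : ℝ))).exists
  exact hint t ht0 htT fun s hs => (hmax0 s hs).trans ht

/-! ### Local minima lie in the open cone -/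

theorem exists_orthogonal (hn : 2 ≤ n) (w : Sph n) :
    ∃ f : Sph n, ⟪(w : E n), (f : E n)⟫ = 0 := by
  have hfr : Module.finrank ℝ ((ℝ ∙ (w : E n))ᗮ : Submodule ℝ (E n)) = n - 1 := by
    have := Submodule.finrank_add_finrank_orthogonal (ℝ ∙ (w : E n))
    rw [finrank_span_singleton (sph_ne_zero w), finrank_euclideanSpace_fin] at this
    omega
  have : Nontrivial ((ℝ ∙ (w : E n))ᗮ : Submodule ℝ (E n)) :=
    Module.nontrivial_of_finrank_pos (R := ℝ) (by omega)
  obtain ⟨f, hf⟩ := exists_norm_eq ((ℝ ∙ (w : E n))ᗮ : Submodule ℝ (E n)) zero_le_one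
  exact ⟨⟨f, mem_sphere_zero_iff_norm.2 hf⟩,
    Submodule.mem_orthogonal_singleton_iff_inner_right.1 f.2⟩

/-- By `psi_neg`, strict midpoint convexity at -w becomes strict midpoint concavity at w. -/
theorem neg_notMem_of_isLocalMin (hn : 2 ≤ n) (hm : 1 ≤ m) {w : Sph n}
    (hloc : IsLocalMin (psi (cone x y)) w) : -w ∉ sphOpenCone x y := by
  intro hw
  obtain ⟨f, hf⟩ := exists_orthogonal hn (-w)
  have hev : ∀ᶠ v in 𝓝 (-w), psi (cone x y) w ≤ psi (cone x y) (-v) := by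
    have : Tendsto (fun v : Sph n => -v) (𝓝 (-w)) (𝓝 w) := by
      simpa using (continuous_neg (G := Sph n)).tendsto (-w)
    exact this.eventually hloc
  have h1 := eventually_arc hf hev
  have h2 : ∀ᶠ t in 𝓝 (0 : ℝ), psi (cone x y) w ≤ psi (cone x y) (-(arc (-w) f hf (-t))) := by
    have : Tendsto (fun t : ℝ => -t) (𝓝 0) (𝓝 0) := by
      simpa using (continuous_neg (G := ℝ)).tendsto 0
    exact this.eventually h1
  obtain ⟨t, ⟨ht1, ht2⟩, ht0, htT⟩ := (((h1.and h2).filter_mono nhdsWithin_le_nhds).and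
    (Ioo_mem_nhdsGT one_pos : Ioo 0 1 ∈ 𝓝[>] (0 : ℝ))).exists
  have := psi_midpoint_lt (x := x) (y := y) hf hm (s := 0) ht0
    (by linarith [Real.pi_gt_three]) (by rwa [arc_zero])
  rw [arc_zero, zero_sub, zero_add, psi_neg] at this
  rw [psi_neg] at ht1 ht2
  linarith

theorem convex_openCone : Convex ℝ (openCone x y) := by
  intro u hu v hv a b ha hb hab
  rcases ha.eq_or_lt with rfl | ha
  · rw [zero_add] at hab
    simpa [hab] using hv
  rcases hb.eq_or_lt with rfl | hb
  · rw [add_zero] at hab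
    simpa [hab] using hu
  exact add_mem_openCone (smul_mem_openCone ha hu) (smul_mem_openCone hb hv)

/-- The line ℝw misses the open cone. A separating functional is bounded below on this line, hence
vanishes on it; its negated, normalized Riesz vector is z. -/
theorem exists_separating (hm : 1 ≤ m) (hne : (openCone x y).Nonempty) {w : Sph n}
    (h1 : w ∉ sphOpenCone x y) (h2 : -w ∉ sphOpenCone x y) :
    ∃ z : Sph n, ⟪(w : E n), (z : E n)⟫ = 0 ∧
      ∀ u ∈ sphOpenCone x y, 0 < ⟪(z : E n), (u : E n)⟫ := by
  have hdisj : Disjoint (openCone x y) ((ℝ ∙ (w : E n) : Submodule ℝ (E n)) : Set (E n)) := by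
    rw [disjoint_left]
    intro v hv hvw
    obtain ⟨c, rfl⟩ := Submodule.mem_span_singleton.1 hvw
    rcases lt_trichotomy c 0 with hc | rfl | hc
    · apply h2
      have := smul_mem_openCone (inv_pos.2 (neg_pos.2 hc)) hv
      rwa [smul_smul, inv_neg, neg_mul, inv_mul_cancel₀ hc.ne, neg_one_smul] at this
    · simpa using hv ⟨0, hm⟩
    · apply h1
      have := smul_mem_openCone (inv_pos.2 hc) hv
      rwa [smul_smul, inv_mul_cancel₀ hc.ne', one_smul] at this
  obtain ⟨g, a, hga, hgb⟩ := geometric_hahn_banach_open convex_openCone isOpen_openCone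
    (Submodule.convex _) hdisj
  have ha : a ≤ 0 := by simpa using hgb 0 (Submodule.zero_mem _)
  have hgw : g w = 0 := by
    by_contra hg
    have := hgb (((a - 1) / g w) • (w : E n))
      (Submodule.smul_mem _ _ (Submodule.mem_span_singleton_self _))
    rw [map_smul, smul_eq_mul, div_mul_cancel₀ _ hg] at this
    linarith
  set z' : E n := -(InnerProductSpace.toDual ℝ (E n)).symm g with hz'
  have hz'i : ∀ v : E n, ⟪z', v⟫ = -g v := fun v => by
    rw [hz', inner_neg_left, InnerProductSpace.toDual_symm_apply]
  have hz'p : ∀ v ∈ openCone x y, 0 < ⟪z', v⟫ := fun v hv => by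
    rw [hz'i]; linarith [hga v hv]
  have hz0 : z' ≠ 0 := by
    intro h
    obtain ⟨v, hv⟩ := hne
    simpa [h] using hz'p v hv
  refine ⟨⟨‖z'‖⁻¹ • z', ?_⟩, ?_, fun u hu => ?_⟩
  · rw [mem_sphere_zero_iff_norm, norm_smul, norm_inv, norm_norm,
      inv_mul_cancel₀ (norm_ne_zero_iff.2 hz0)]
  · rw [real_inner_comm, inner_smul_left, hz'i, hgw]
    simp
  · rw [inner_smul_left]
    have := norm_pos_iff.2 hz0
    exact mul_pos (by simpa using this) (hz'p u hu)

theorem hasDerivAt_geo_arc {e f : Sph n} (hef : ⟪(e : E n), (f : E n)⟫ = 0) {u : Sph n}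
    (h1 : u ≠ e) (h2 : u ≠ -e) :
    HasDerivAt (fun t => geo (arc e f hef t) u)
      (-(⟪(f : E n), (u : E n)⟫ / √(1 - ⟪(e : E n), (u : E n)⟫ ^ 2))) 0 := by
  simp only [geo_eq_arccos, inner_arc_left]
  have hd : HasDerivAt (fun t : ℝ => Real.cos t * ⟪(e : E n), (u : E n)⟫ +
      Real.sin t * ⟪(f : E n), (u : E n)⟫) ⟪(f : E n), (u : E n)⟫ 0 := by
    have := ((Real.hasDerivAt_cos 0).mul_const ⟪(e : E n), (u : E n)⟫).fun_add
      ((Real.hasDerivAt_sin 0).mul_const ⟪(f : E n), (u : E n)⟫)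
    simpa using this
  have hne1 : ⟪(e : E n), (u : E n)⟫ ≠ -1 := by
    intro h
    refine h2 (eq_neg_of_geo_eq_pi ?_)
    rw [geo_eq_arccos, h, Real.arccos_neg_one]
  have hne2 : ⟪(e : E n), (u : E n)⟫ ≠ 1 := by
    intro h
    refine h1 (eq_of_geo_eq_zero ?_).symm
    rw [geo_eq_arccos, h, Real.arccos_one]
  have hv : Real.cos 0 * ⟪(e : E n), (u : E n)⟫ + Real.sin 0 * ⟪(f : E n), (u : E n)⟫ =
      ⟪(e : E n), (u : E n)⟫ := by simp
  have ha := Real.hasDerivAt_arccos hne1 hne2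
  rw [← hv] at ha
  have := ha.comp (0 : ℝ) hd
  rw [hv] at this
  refine this.congr_deriv ?_
  ring

/-- Turning w towards z decreases the distance to every u in the open cone at a positive rate, so ψ
has negative derivative. Neither w nor -w is in the open cone, so each distance is differentiable
there; the Lipschitz bound 1 justifies differentiating under the integral. -/
theorem mem_sphOpenCone_of_isLocalMin (hn : 2 ≤ n) (hm : 1 ≤ m) (hne : (openCone x y).Nonempty)
    {w : Sph n} (hloc : IsLocalMin (psi (cone x y)) w) : w ∈ sphOpenCone x y := by
  by_contra h1
  have h2 := neg_notMem_of_isLocalMin hn hm hloc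
  obtain ⟨z, hwz, hz⟩ := exists_separating hm hne h1 h2
  set F' : Sph n → ℝ := fun u => ⟪(z : E n), (u : E n)⟫ / √(1 - ⟪(w : E n), (u : E n)⟫ ^ 2)
    with hF'
  have hmeas : Measurable F' := by
    rw [hF']
    fun_prop
  have hne' : ∀ u ∈ sphOpenCone x y, u ≠ w ∧ u ≠ -w := fun u hu =>
    ⟨fun h => h1 (h ▸ hu), fun h => h2 (h ▸ hu)⟩
  have hpos : ∀ u ∈ sphOpenCone x y, 0 < F' u := by
    intro u hu
    refine div_pos (hz u hu) (Real.sqrt_pos.2 ?_)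
    have hle : |⟪(w : E n), (u : E n)⟫| ≤ 1 := by
      simpa using abs_real_inner_le_norm (w : E n) (u : E n)
    have hlt : |⟪(w : E n), (u : E n)⟫| < 1 := by
      refine lt_of_le_of_ne hle fun h => ?_
      rcases (abs_eq one_pos.le).1 h with h | h
      · refine (hne' u hu).1 (eq_of_geo_eq_zero ?_).symm
        rw [geo_eq_arccos, h, Real.arccos_one]
      · refine (hne' u hu).2 (eq_neg_of_geo_eq_pi ?_)
        rw [geo_eq_arccos, h, Real.arccos_neg_one]
    have := (sq_lt_one_iff_abs_lt_one _).2 hlt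
    linarith
  have hO : MeasurableSet (sphOpenCone x y) := isOpen_sphOpenCone.measurableSet
  have hder := hasDerivAt_integral_of_dominated_loc_of_lip
    (μ := (unif n).restrict (sphOpenCone x y)) (F := fun t u => geo (arc w z hwz t) u)
    (F' := fun u => -F' u) (x₀ := (0 : ℝ)) (s := univ) (bound := fun _ => (1 : ℝ)) univ_mem
    (Eventually.of_forall fun t => (continuous_geo_right _).aestronglyMeasurable)
    (integrable_of_continuous (continuous_geo_right _)).integrableOn
    hmeas.neg.aestronglyMeasurable
    (Eventually.of_forall fun u => LipschitzOnWith.of_dist_le_mul fun s _ t _ => by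
      simp only [Real.dist_eq]
      refine (abs_geo_sub_le _ _ _).trans ((geo_arc_le hwz s t).trans_eq ?_)
      simp)
    (integrable_const _)
    ((ae_restrict_iff' hO).2 (Eventually.of_forall fun u hu =>
      hasDerivAt_geo_arc hwz (hne' u hu).1 (hne' u hu).2))
  have hloc0 : IsLocalMin
      (fun t => ∫ u in sphOpenCone x y, geo (arc w z hwz t) u ∂(unif n)) 0 := by
    have := eventually_arc hwz hloc
    simp only [psi_cone_eq] at this
    rw [IsLocalMin, IsMinFilter]
    simpa only [arc_zero] using this
  have hzero := hloc0.hasDerivAt_eq_zero hder.2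
  rw [integral_neg, neg_eq_zero] at hzero
  have hint : Integrable F' ((unif n).restrict (sphOpenCone x y)) := by
    simpa using hder.1.neg
  have hlt := (setIntegral_pos_iff_support_of_nonneg_ae
    ((ae_restrict_iff' hO).2 (Eventually.of_forall fun u hu => (hpos u hu).le)) hint).2
    ((isOpen_sphOpenCone.measure_pos (unif n) (sphOpenCone_nonempty hm hne)).trans_le
      (measure_mono fun u hu => ⟨(hpos u hu).ne', hu⟩))
  exact hlt.ne' hzero

/-! ### Existence and uniqueness of the minimizer -/

theorem exists_isMin (hn : 1 ≤ n) (K : Set (E n)) : ∃ w, ∀ w', psi K w ≤ psi K w' := by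
  have : NeZero n := ⟨by omega⟩
  have : Nonempty (Sph n) := (NormedSpace.sphere_nonempty.2 zero_le_one).to_subtype
  obtain ⟨w, -, hw⟩ := isCompact_univ.exists_isMinOn univ_nonempty (continuous_psi K).continuousOn
  exact ⟨w, fun w' => hw (mem_univ w')⟩

theorem eq_or_eq_neg_of_dim_one (v w : Sph 1) : w = v ∨ w = -v := by
  have h : ∀ v : Sph 1, (v : E 1) 0 ^ 2 = 1 := fun v => by
    have := EuclideanSpace.real_norm_sq_eq (v : E 1)
    rwa [norm_eq_of_mem_sphere, one_pow, Fin.sum_univ_one, eq_comm] at this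
  have hvw : (w : E 1) 0 = (v : E 1) 0 ∨ (w : E 1) 0 = -(v : E 1) 0 :=
    sq_eq_sq_iff_eq_or_eq_neg.1 ((h w).trans (h v).symm)
  refine hvw.imp (fun h => ?_) fun h => ?_ <;>
  · apply Subtype.ext
    ext i
    rw [Subsingleton.elim i 0]
    simpa using h

theorem existsUnique_isMin (hn : 1 ≤ n) (hm : 1 ≤ m) (hne : (openCone x y).Nonempty) :
    ∃! w, ∀ w', psi (cone x y) w ≤ psi (cone x y) w' := by
  rcases hn.eq_or_lt with rfl | hn2
  -- In dimension one the sphere has two points, each trivially a local minimum, so they are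
  -- compared directly.
  · obtain ⟨k, hk⟩ := sphOpenCone_nonempty hm hne
    have hkk : psi (cone x y) k = 0 := by
      rw [psi_cone_eq]
      refine setIntegral_eq_zero_of_forall_eq_zero fun u hu => ?_
      rcases eq_or_eq_neg_of_dim_one k u with rfl | rfl
      · exact geo_self _
      · exact absurd (openCone_subset_cone hu) (neg_notMem_cone hm hk)
    have hneg : 0 < psi (cone x y) (-k) := by
      rw [psi_neg, hkk, sub_zero]
      refine mul_pos Real.pi_pos (ENNReal.toReal_pos ?_ (measure_ne_top _ _))
      exact ((isOpen_sphOpenCone.measure_pos (unif 1) ⟨k, hk⟩).trans_le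
        (measure_mono fun u hu => openCone_subset_cone hu)).ne'
    refine ⟨k, fun w' => ?_, fun w hw => ?_⟩
    · rcases eq_or_eq_neg_of_dim_one k w' with rfl | rfl
      · exact le_rfl
      · rw [hkk]; exact hneg.le
    · rcases eq_or_eq_neg_of_dim_one k w with rfl | rfl
      · rfl
      · exact absurd (hw k) (by rw [hkk]; exact hneg.not_ge)
  · obtain ⟨w, hw⟩ := exists_isMin hn (cone x y)
    have hl : ∀ v, (∀ w', psi (cone x y) v ≤ psi (cone x y) w') → v ∈ sphOpenCone x y :=
      fun v hv => mem_sphOpenCone_of_isLocalMin hn2 hm hne (Eventually.of_forall hv)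
    exact ⟨w, hw, fun v hv =>
      eq_of_isLocalMin_of_isMin hm (hl v hv) (hl w hw) (Eventually.of_forall hv) hw⟩

theorem eq_of_isLocalMin (hn : 2 ≤ n) (hm : 1 ≤ m) (hne : (openCone x y).Nonempty) {v w : Sph n}
    (hv : IsLocalMin (psi (cone x y)) v)
    (hw : ∀ w', psi (cone x y) w ≤ psi (cone x y) w') : v = w :=
  eq_of_isLocalMin_of_isMin hm (mem_sphOpenCone_of_isLocalMin hn hm hne hv)
    (mem_sphOpenCone_of_isLocalMin hn hm hne (Eventually.of_forall hw)) hv hw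

/-! ### The minimizer lies in the cone generated by the examples -/

/-- The reflected w is w plus a nonnegative multiple of b, hence at least as close to every u in the
hemisphere of b; folding along b does the rest. -/
theorem psi_act_refl_le {b w : Sph n} (hb : b ∈ sphCone x y) (hwb : ⟪(w : E n), (b : E n)⟫ ≤ 0) :
    psi (cone x y) (act (refl b) w) ≤ psi (cone x y) w := by
  have hDc : Continuous fun u => geo w u - geo (act (refl b) w) u :=
    (continuous_geo_right _).sub (continuous_geo_right _)
  have key := setIntegral_nonneg_of_fold (b := b) (κ := sphCone x y)
    isClosed_sphCone.measurableSet hDc (fun u hu h => act_refl_mem_sphCone hb hu h)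
    (fun u => by simp only [geo_act_refl, act_refl_act_refl]; ring)
    (fun u hu => sub_nonneg.2 (geo_le_geo (by
      rw [coe_act, refl_apply, inner_sub_left, inner_smul_left, real_inner_comm (u : E n),
        real_inner_comm (w : E n) (b : E n)]
      simp only [conj_trivial]
      rw [real_inner_comm] at hu
      nlinarith [mul_nonneg (neg_nonneg.2 hwb) hu])))
  have hi : ∀ v : Sph n, Integrable (fun u => geo v u) ((unif n).restrict (sphCone x y)) :=
    fun v => (integrable_of_continuous (continuous_geo_right v)).integrableOn
  rw [integral_sub (hi _) (hi _)] at key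
  exact sub_nonneg.1 key

/-- Otherwise reflecting w along v would give another minimizer, different from w. -/
theorem inner_nonneg_of_isMin (hn : 1 ≤ n) (hm : 1 ≤ m) (hne : (openCone x y).Nonempty)
    {w : Sph n} (hw : ∀ w', psi (cone x y) w ≤ psi (cone x y) w') {v : E n} (hv : v ∈ cone x y) :
    0 ≤ ⟪(w : E n), v⟫ := by
  by_contra hlt
  rw [not_le] at hlt
  have hv0 : v ≠ 0 := by
    rintro rfl
    simp at hlt
  have hnv := norm_pos_iff.2 hv0
  let b : Sph n := ⟨‖v‖⁻¹ • v, by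
    rw [mem_sphere_zero_iff_norm, norm_smul, norm_inv, norm_norm, inv_mul_cancel₀ hnv.ne']⟩
  have hb : b ∈ sphCone x y := smul_mem_cone (inv_pos.2 hnv).le hv
  have hwb : ⟪(w : E n), (b : E n)⟫ < 0 := by
    change ⟪(w : E n), ‖v‖⁻¹ • v⟫ < 0
    rw [inner_smul_right]
    exact mul_neg_of_pos_of_neg (inv_pos.2 hnv) hlt
  have hle := psi_act_refl_le hb hwb.le
  have heq : act (refl b) w = w :=
    (existsUnique_isMin hn hm hne).unique (fun w' => hle.trans (hw w')) hw
  have h1 : refl b (w : E n) = w := congrArg Subtype.val heq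
  rw [refl_apply, sub_eq_self, smul_eq_zero] at h1
  rcases h1 with h1 | h1
  · rw [real_inner_comm] at h1
    linarith
  · exact sph_ne_zero b h1

/-- The convex cone generated by a finite family of vectors on which some linear form is
positive is closed. -/
theorem isClosed_generated {s : Fin m → E n} {v : E n} (hv : ∀ i, 0 < ⟪v, s i⟫) :
    IsClosed {w : E n | ∃ α : Fin m → ℝ, (∀ i, 0 ≤ α i) ∧ w = ∑ i, α i • s i} := by
  rw [← closure_subset_iff_isClosed]
  intro w hw
  -- Near w the form ⟪v, ·⟫ stays below M, which bounds every coefficient; locally the cone is the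
  -- image of a compact box.
  set M := ⟪v, w⟫ + 1
  have hcpt : IsCompact ((fun α : Fin m → ℝ => ∑ i, α i • s i) ''
      (univ.pi fun i => Icc (0 : ℝ) (M / ⟪v, s i⟫))) :=
    (isCompact_univ_pi fun i => isCompact_Icc).image (by fun_prop)
  have hmem : w ∈ closure ((fun α : Fin m → ℝ => ∑ i, α i • s i) ''
      (univ.pi fun i => Icc (0 : ℝ) (M / ⟪v, s i⟫))) := by
    rw [mem_closure_iff] at hw ⊢
    intro o ho hwo
    obtain ⟨w', ⟨hw'o, hw'M⟩, α, hα, rfl⟩ := hw (o ∩ {w' | ⟪v, w'⟫ < M})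
      (ho.inter (isOpen_lt (by fun_prop) continuous_const)) ⟨hwo, by
        change ⟪v, w⟫ < ⟪v, w⟫ + 1
        linarith⟩
    refine ⟨_, hw'o, α, fun i _ => ⟨hα i, ?_⟩, rfl⟩
    rw [le_div_iff₀ (hv i)]
    simp only [mem_ofPred_eq, inner_sum, inner_smul_right] at hw'M
    exact (Finset.single_le_sum (f := fun i => α i * ⟪v, s i⟫)
      (fun i _ => mul_nonneg (hα i) (hv i).le) (Finset.mem_univ i)).trans hw'M.le
  rw [hcpt.isClosed.closure_eq] at hmem
  obtain ⟨α, hα, rfl⟩ := hmem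
  exact ⟨α, fun i => (hα i (mem_univ i)).1, rfl⟩

/-- Farkas: a point outside the closed generated cone is strictly separated from it by some b that
is nonnegative on all generators. -/
theorem exists_nonneg_combination {s : Fin m → E n} {v : E n} (hv : ∀ i, 0 < ⟪v, s i⟫) {w : E n}
    (hw : ∀ b : E n, (∀ i, 0 ≤ ⟪b, s i⟫) → 0 ≤ ⟪w, b⟫) :
    ∃ α : Fin m → ℝ, (∀ i, 0 ≤ α i) ∧ w = ∑ i, α i • s i := by
  by_contra hcon
  have hconv : Convex ℝ {w : E n | ∃ α : Fin m → ℝ, (∀ i, 0 ≤ α i) ∧ w = ∑ i, α i • s i} := by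
    rintro _ ⟨α, hα, rfl⟩ _ ⟨β, hβ, rfl⟩ a b ha hb -
    refine ⟨fun i => a * α i + b * β i, fun i =>
      add_nonneg (mul_nonneg ha (hα i)) (mul_nonneg hb (hβ i)), ?_⟩
    simp only [Finset.smul_sum, smul_smul, add_smul, Finset.sum_add_distrib]
  obtain ⟨g, a, hga, hgb⟩ := geometric_hahn_banach_point_closed hconv (isClosed_generated hv) hcon
  have h0 : a < 0 := by
    simpa using hgb 0 ⟨0, fun _ => le_rfl, by simp⟩
  set b := (InnerProductSpace.toDual ℝ (E n)).symm g with hb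
  have hbi : ∀ v : E n, ⟪b, v⟫ = g v := fun v => by
    rw [hb, InnerProductSpace.toDual_symm_apply]
  have hgs : ∀ i, 0 ≤ ⟪b, s i⟫ := by
    intro i
    rw [hbi]
    by_contra hneg
    rw [not_le] at hneg
    -- This multiple has g-value exactly a, against the strict bound.
    have := hgb ((a / g (s i)) • s i) ⟨Pi.single i (a / g (s i)), fun j => ?_, ?_⟩
    · rw [map_smul, smul_eq_mul, div_mul_cancel₀ _ hneg.ne] at this
      exact lt_irrefl _ this
    · rcases eq_or_ne j i with rfl | hji
      · rw [Pi.single_eq_same]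
        exact div_nonneg_of_nonpos h0.le hneg.le
      · rw [Pi.single_eq_of_ne hji]
    · rw [Finset.sum_eq_single i]
      · rw [Pi.single_eq_same]
      · intro j _ hji
        rw [Pi.single_eq_of_ne hji, zero_smul]
      · simp
  have := hw b hgs
  rw [real_inner_comm, hbi] at this
  linarith

end Minimizers

/-! ### The risk formula -/

section Risk

variable {n m : ℕ}

theorem isProbabilityMeasure_sampleLaw (hn : 1 ≤ n) : IsProbabilityMeasure (sampleLaw n m) := by
  have := isProbabilityMeasure_unif hn
  unfold sampleLaw
  infer_instance

theorem measurable_label (s₀ : ℤˣ) :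
    Measurable fun p : Sph n × (Fin m → Sph n) => label s₀ p.1 p.2 :=
  measurable_pi_lambda _ fun i => (measurable_sgn s₀).comp (by fun_prop)

theorem mem_sphOpenCone_iff_label {s₀ : ℤˣ} {u : Sph n} {x : Fin m → Sph n} {y : Fin m → ℤˣ}
    (hu : ∀ i, ⟪(u : E n), (x i : E n)⟫ ≠ 0) : u ∈ sphOpenCone x y ↔ label s₀ u x = y := by
  rw [funext_iff]
  refine forall_congr' fun i => ?_
  have h1 : (-1 : ℤˣ) ≠ 1 := by decide
  rcases lt_or_gt_of_ne (hu i) with h | h <;>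
  rcases Int.units_eq_one_or (y i) with hy | hy <;>
    simp [signed, label, sgn, hy, h, h.not_gt, h1, h1.symm]

/-- For almost every u exactly one cone contains u, the one of its own labels, and on each cone f(x,
·) is constant; so f need not be measurable. -/
theorem integral_geo_label (s₀ : ℤˣ) (f : Rule n m) (x : Fin m → Sph n) :
    ∫ u, geo (f (x, label s₀ u x)) u ∂(unif n) = ∑ y, psi (cone x y) (f (x, y)) := by
  have hae : (fun u => geo (f (x, label s₀ u x)) u) =ᵐ[unif n]
      fun u => ∑ y, (sphCone x y).indicator (fun u => geo (f (x, y)) u) u := by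
    filter_upwards [ae_sphCone_iff x, ae_all_iff.2 fun i => ae_inner_ne_zero (x i)] with u h1 h2
    rw [Finset.sum_eq_single (label s₀ u x)]
    · rw [indicator_of_mem ((h1 _).2 ((mem_sphOpenCone_iff_label h2).2 rfl))]
    · intro y _ hy
      exact indicator_of_notMem
        (fun h => hy ((mem_sphOpenCone_iff_label h2).1 ((h1 y).1 h)).symm) _
    · simp
  rw [integral_congr_ae hae, integral_finsetSum]
  · exact Finset.sum_congr rfl fun y _ => integral_indicator isClosed_sphCone.measurableSet
  · exact fun y _ => (integrable_of_continuous (continuous_geo_right _)).indicator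
      isClosed_sphCone.measurableSet

theorem integrable_geo_label (hn : 1 ≤ n) (s₀ : ℤˣ) {f : Rule n m} (hf : Measurable f) :
    Integrable (fun p : Sph n × (Fin m → Sph n) => geo (f (p.2, label s₀ p.1 p.2)) p.1)
      ((unif n).prod (sampleLaw n m)) := by
  have := isProbabilityMeasure_unif hn
  have := isProbabilityMeasure_sampleLaw (m := m) hn
  have hmeas : Measurable
      (fun p : Sph n × (Fin m → Sph n) => geo (f (p.2, label s₀ p.1 p.2)) p.1) := by
    have hfm : Measurable fun p : Sph n × (Fin m → Sph n) => f (p.2, label s₀ p.1 p.2) :=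
      hf.comp (measurable_snd.prodMk (measurable_label s₀))
    simp only [geo_eq_arccos]
    exact Real.continuous_arccos.measurable.comp
      ((measurable_subtype_coe.comp hfm).inner (measurable_subtype_coe.comp measurable_fst))
  refine Integrable.of_bound hmeas.aestronglyMeasurable Real.pi (Eventually.of_forall fun p => ?_)
  rw [Real.norm_eq_abs, abs_of_nonneg (geo_nonneg _ _)]
  exact geo_le_pi _ _

theorem integrable_sum_psi (hn : 1 ≤ n) {f : Rule n m} (hf : Measurable f) :
    Integrable (fun x => ∑ y, psi (cone x y) (f (x, y))) (sampleLaw n m) := by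
  have := isProbabilityMeasure_sampleLaw (m := m) hn
  -- The sign 1 at zero is arbitrary, as the sum does not depend on it.
  have := (integrable_geo_label hn 1 hf).integral_prod_right
  simpa only [integral_geo_label] using this

theorem risk_eq (hn : 1 ≤ n) (s₀ : ℤˣ) {f : Rule n m} (hf : Measurable f) :
    risk s₀ f = Real.pi⁻¹ * ∫ x, ∑ y, psi (cone x y) (f (x, y)) ∂(sampleLaw n m) := by
  have := isProbabilityMeasure_sampleLaw (m := m) hn
  have hswap := integral_integral_swap
    (f := fun (u : Sph n) (x : Fin m → Sph n) => geo (f (x, label s₀ u x)) u)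
    (integrable_geo_label hn s₀ hf)
  simp only [integral_geo_label] at hswap
  rw [← hswap, risk, ← integral_const_mul]
  refine integral_congr_ae (Eventually.of_forall fun u => ?_)
  simp only [disagree_eq_geo_div_pi hn]
  rw [← integral_const_mul]
  simp only [div_eq_inv_mul]

end Risk

/-! ### Joint continuity of `ψ` -/

section Continuity

variable {n m : ℕ}

theorem continuous_signed (y : Fin m → ℤˣ) (i : Fin m) :
    Continuous fun x : Fin m → Sph n => signed x y i := by
  unfold signed
  fun_prop

/-- Dominated convergence with bound π: for u off the null boundary of the cone at x₀, membership of
u is locally constant in x. -/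
theorem continuous_psi_cone (y : Fin m → ℤˣ) :
    Continuous fun p : (Fin m → Sph n) × Sph n => psi (cone p.1 y) p.2 := by
  have heq : ∀ p : (Fin m → Sph n) × Sph n, psi (cone p.1 y) p.2 =
      ∫ u, (sphCone p.1 y).indicator (fun u => geo p.2 u) u ∂(unif n) := fun p =>
    (integral_indicator isClosed_sphCone.measurableSet).symm
  simp only [heq]
  rw [continuous_iff_continuousAt]
  rintro ⟨x₀, w₀⟩
  refine continuousAt_of_dominated (bound := fun _ => Real.pi)
    (Eventually.of_forall fun p => ((continuous_geo_right _).measurable.indicator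
      isClosed_sphCone.measurableSet).aestronglyMeasurable)
    (Eventually.of_forall fun p => Eventually.of_forall fun u => ?_) (integrable_const _) ?_
  · refine (norm_indicator_le_norm_self _ _).trans ?_
    rw [Real.norm_eq_abs, abs_of_nonneg (geo_nonneg _ _)]
    exact geo_le_pi _ _
  · filter_upwards [ae_sphCone_iff x₀] with u hu
    have hg : ContinuousAt (fun p : (Fin m → Sph n) × Sph n => geo p.2 u) (x₀, w₀) := by
      have : Continuous fun p : (Fin m → Sph n) × Sph n => geo p.2 u := by
        simp only [geo_eq_arccos]
        fun_prop
      exact this.continuousAt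
    have hs : ∀ i, Continuous fun p : (Fin m → Sph n) × Sph n => ⟪(u : E n), signed p.1 y i⟫ :=
      fun i => continuous_const.inner ((continuous_signed y i).comp continuous_fst)
    by_cases h : u ∈ sphOpenCone x₀ y
    · refine hg.congr ?_
      have hev : ∀ᶠ p : (Fin m → Sph n) × Sph n in 𝓝 (x₀, w₀), ∀ i,
          0 < ⟪(u : E n), signed p.1 y i⟫ :=
        eventually_all.2 fun i => (hs i).continuousAt.eventually (lt_mem_nhds (h i))
      filter_upwards [hev] with p hp
      rw [indicator_of_mem]
      exact fun i => (hp i).le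
    · have h' : u ∉ sphCone x₀ y := fun h' => h ((hu y).1 h')
      obtain ⟨i, hi⟩ := not_forall.1 h'
      refine (continuousAt_const (y := (0 : ℝ))).congr ?_
      filter_upwards [(hs i).continuousAt.eventually (gt_mem_nhds (not_le.1 hi))] with p hp
      rw [indicator_of_notMem]
      exact fun hmem => absurd (hmem i) hp.not_ge

end Continuity

/-! ### The optimal rule -/

section OptimalRule

variable {n m : ℕ}

open Classical in
/-- The rule choosing the minimizer of `ψ` on every cone with nonempty interior, and the first
example otherwise. -/
noncomputable def optRule (hn : 1 ≤ n) (hm : 1 ≤ m) : Rule n m := fun p =>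
  if (interior (cone p.1 p.2)).Nonempty then (exists_isMin hn (cone p.1 p.2)).choose
  else p.1 ⟨0, hm⟩

theorem optRule_isMin (hn : 1 ≤ n) (hm : 1 ≤ m) {x : Fin m → Sph n} {y : Fin m → ℤˣ}
    (h : (interior (cone x y)).Nonempty) (w : Sph n) :
    psi (cone x y) (optRule hn hm (x, y)) ≤ psi (cone x y) w := by
  rw [optRule, if_pos h]
  exact (exists_isMin hn (cone x y)).choose_spec w

theorem eq_optRule (hn : 1 ≤ n) (hm : 1 ≤ m) {x : Fin m → Sph n} {y : Fin m → ℤˣ}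
    (h : (interior (cone x y)).Nonempty) {w : Sph n}
    (hw : ∀ w', psi (cone x y) w ≤ psi (cone x y) w') : w = optRule hn hm (x, y) :=
  (existsUnique_isMin hn hm (interior_cone ▸ h)).unique hw (optRule_isMin hn hm h)

theorem psi_optRule_le (hn : 1 ≤ n) (hm : 1 ≤ m) (x : Fin m → Sph n) (y : Fin m → ℤˣ)
    (w : Sph n) : psi (cone x y) (optRule hn hm (x, y)) ≤ psi (cone x y) w := by
  by_cases h : (interior (cone x y)).Nonempty
  · exact optRule_isMin hn hm h w
  · rw [psi_eq_zero_of_interior_empty h, psi_eq_zero_of_interior_empty h]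

theorem isOpen_setOf_interior_nonempty (y : Fin m → ℤˣ) :
    IsOpen {x : Fin m → Sph n | (interior (cone x y)).Nonempty} := by
  have : {x : Fin m → Sph n | (interior (cone x y)).Nonempty} =
      ⋃ v : E n, ⋂ i, {x | 0 < ⟪v, signed x y i⟫} := by
    ext x
    rw [mem_ofPred_eq, interior_cone]
    simp [Set.Nonempty, openCone]
  rw [this]
  exact isOpen_iUnion fun v => isOpen_iInter_of_finite fun i =>
    isOpen_lt continuous_const (continuous_const.inner (continuous_signed y i))

/-- On the compact sphere it suffices that every cluster point of minimizers is the minimizer at x₀.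
A strictly better competitor w' would by joint continuity also beat minimizers at nearby x. -/
theorem continuousOn_optRule (hn : 1 ≤ n) (hm : 1 ≤ m) (y : Fin m → ℤˣ) :
    ContinuousOn (fun x => optRule hn hm (x, y))
      {x : Fin m → Sph n | (interior (cone x y)).Nonempty} := by
  intro x₀ hx₀
  refine isCompact_univ.tendsto_nhds_of_unique_mapClusterPt
    (Eventually.of_forall fun _ => mem_univ _) fun w _ hw => eq_optRule hn hm hx₀ fun w' => ?_
  by_contra hlt
  have hc : Continuous fun p : (Fin m → Sph n) × Sph n =>
      psi (cone p.1 y) p.2 - psi (cone p.1 y) w' :=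
    (continuous_psi_cone y).sub
      ((continuous_psi_cone y).comp (continuous_fst.prodMk continuous_const))
  have hev := (hc.tendsto (x₀, w)).eventually (lt_mem_nhds (sub_pos.2 (not_le.1 hlt)))
  rw [nhds_prod_eq] at hev
  obtain ⟨P, hP, Q, hQ, hPQ⟩ := eventually_prod_iff.1 hev
  obtain ⟨x, hQx, hPx, hx⟩ := ((mapClusterPt_iff_frequently.1 hw _ hQ).and_eventually
    ((hP.filter_mono nhdsWithin_le_nhds).and self_mem_nhdsWithin)).exists
  exact absurd (hPQ hPx hQx) (sub_nonpos.2 (optRule_isMin hn hm hx w')).not_gt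

theorem measurable_optRule (hn : 1 ≤ n) (hm : 1 ≤ m) : Measurable (optRule (m := m) hn hm) := by
  classical
  refine measurable_from_prod_countable_left fun y => ?_
  have := (continuousOn_optRule hn hm y).measurable_piecewise
    (g := fun x : Fin m → Sph n => x ⟨0, hm⟩) (continuous_apply _).continuousOn
    (isOpen_setOf_interior_nonempty y).measurableSet
  convert this using 1
  ext1 x
  by_cases h : (interior (cone x y)).Nonempty
  · simp only [piecewise, mem_ofPred_eq, if_pos h]
  · simp only [piecewise, mem_ofPred_eq, if_neg h]
    rw [optRule, if_neg h]

theorem risk_optRule_le (hn : 1 ≤ n) (hm : 1 ≤ m) (s₀ : ℤˣ) {g : Rule n m} (hg : Measurable g) :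
    risk s₀ (optRule hn hm) ≤ risk s₀ g := by
  rw [risk_eq hn s₀ (measurable_optRule hn hm), risk_eq hn s₀ hg]
  refine mul_le_mul_of_nonneg_left ?_ (inv_pos.2 Real.pi_pos).le
  exact integral_mono (integrable_sum_psi hn (measurable_optRule hn hm)) (integrable_sum_psi hn hg)
    fun x => Finset.sum_le_sum fun y _ => psi_optRule_le hn hm x y _

theorem isOptimal_optRule (hn : 1 ≤ n) (hm : 1 ≤ m) (s₀ : ℤˣ) :
    IsOptimal s₀ (optRule (m := m) hn hm) :=
  ⟨measurable_optRule hn hm, fun _ hg => risk_optRule_le hn hm s₀ hg⟩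

/-- Since the optimal rule is termwise minimal, equal integrals force equal sums almost everywhere,
hence equal terms; uniqueness of minimizers then identifies the values. -/
theorem isOptimal_iff (hn : 1 ≤ n) (hm : 1 ≤ m) (s₀ : ℤˣ) {f : Rule n m} (hf : Measurable f) :
    IsOptimal s₀ f ↔ ∀ᵐ x ∂(sampleLaw n m), ∀ y : Fin m → ℤˣ,
      (interior (cone x y)).Nonempty → f (x, y) = optRule hn hm (x, y) := by
  have h1 : IsOptimal s₀ f ↔ risk s₀ (optRule hn hm) = risk s₀ f :=
    ⟨fun h => le_antisymm (risk_optRule_le hn hm s₀ hf) (h.2 _ (measurable_optRule hn hm)),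
      fun h => ⟨hf, fun g hg => h ▸ risk_optRule_le hn hm s₀ hg⟩⟩
  rw [h1, risk_eq hn s₀ (measurable_optRule hn hm), risk_eq hn s₀ hf,
    mul_right_inj' (inv_ne_zero Real.pi_ne_zero),
    integral_eq_iff_of_ae_le (integrable_sum_psi hn (measurable_optRule hn hm))
      (integrable_sum_psi hn hf)
      (Eventually.of_forall fun x => Finset.sum_le_sum fun y _ => psi_optRule_le hn hm x y _)]
  refine eventually_congr (Eventually.of_forall fun x => ?_)
  rw [Finset.sum_eq_sum_iff_of_le fun y _ => psi_optRule_le hn hm x y _]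
  refine ⟨fun h y hy => eq_optRule hn hm hy fun w' => ?_, fun h y _ => ?_⟩
  · rw [← h y (Finset.mem_univ y)]
    exact psi_optRule_le hn hm x y w'
  · by_cases hy : (interior (cone x y)).Nonempty
    · rw [h y hy]
    · rw [psi_eq_zero_of_interior_empty hy, psi_eq_zero_of_interior_empty hy]

/-! ### Equivariance -/

theorem inner_map_signed_act (V : E n ≃ₗᵢ[ℝ] E n) (x : Fin m → Sph n) (y : Fin m → ℤˣ)
    (v : E n) (i : Fin m) :
    ⟪V v, signed (fun i => act V (x i)) y i⟫ = ⟪v, signed x y i⟫ := by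
  simp only [signed, coe_act, inner_smul_right, V.inner_map_map]

theorem psi_act (V : E n ≃ₗᵢ[ℝ] E n) (x : Fin m → Sph n) (y : Fin m → ℤˣ) (w : Sph n) :
    psi (cone (fun i => act V (x i)) y) (act V w) = psi (cone x y) w := by
  have hpre : act V ⁻¹' sphCone (fun i => act V (x i)) y = sphCone x y := by
    ext u
    exact forall_congr' fun i => by rw [coe_act, inner_map_signed_act]
  have := (measurePreserving_act V).setIntegral_preimage_emb (measurableEmbedding_act V)
    (fun u => geo (act V w) u) (sphCone (fun i => act V (x i)) y)
  rw [hpre] at this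
  simp only [geo_act_act] at this
  exact this.symm

theorem interior_cone_act_nonempty (V : E n ≃ₗᵢ[ℝ] E n) {x : Fin m → Sph n} {y : Fin m → ℤˣ} :
    (interior (cone (fun i => act V (x i)) y)).Nonempty ↔ (interior (cone x y)).Nonempty := by
  rw [interior_cone, interior_cone]
  refine ⟨fun ⟨v, hv⟩ => ⟨V.symm v, fun i => ?_⟩, fun ⟨v, hv⟩ => ⟨V v, fun i => ?_⟩⟩
  · rw [← inner_map_signed_act V, V.apply_symm_apply]
    exact hv i
  · rw [inner_map_signed_act]
    exact hv i

theorem optRule_act (hn : 1 ≤ n) (hm : 1 ≤ m) (V : E n ≃ₗᵢ[ℝ] E n) (x : Fin m → Sph n)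
    (y : Fin m → ℤˣ) :
    optRule hn hm (fun i => act V (x i), y) = act V (optRule hn hm (x, y)) := by
  by_cases h : (interior (cone x y)).Nonempty
  · refine (eq_optRule hn hm ((interior_cone_act_nonempty V).2 h) fun w' => ?_).symm
    rw [psi_act, ← act_act_symm V w', psi_act]
    exact optRule_isMin hn hm h _
  -- The default value is an example, so it moves along with V.
  · rw [optRule, if_neg ((interior_cone_act_nonempty V).not.2 h), optRule, if_neg h]

end OptimalRule

end HalfspaceLearning

theorem mainTheorem2 (n m : ℕ) (hn : 1 ≤ n) (hm : 1 ≤ m) (s₀ : ℤˣ) :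
    -- the disagreement probability is the geodesic distance divided by `π`
    (∀ v u : HalfspaceLearning.Sph n,
      HalfspaceLearning.disagree s₀ v u = HalfspaceLearning.geo v u / Real.pi) ∧
    -- the formula for `Ω(f)`, all expectations being those of integrable functions
    (∀ f : HalfspaceLearning.Rule n m, Measurable f →
      Integrable
        (fun p : HalfspaceLearning.Sph n × (Fin m → HalfspaceLearning.Sph n) =>
          HalfspaceLearning.disagree s₀ (f (p.2, HalfspaceLearning.label s₀ p.1 p.2)) p.1)
        ((HalfspaceLearning.unif n).prod (HalfspaceLearning.sampleLaw n m)) ∧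
      Integrable
        (fun x : Fin m → HalfspaceLearning.Sph n => ∑ y : Fin m → ℤˣ,
          HalfspaceLearning.psi (HalfspaceLearning.cone x y) (f (x, y)))
        (HalfspaceLearning.sampleLaw n m) ∧
      HalfspaceLearning.risk s₀ f =
        Real.pi⁻¹ * ∫ x, ∑ y : Fin m → ℤˣ,
          HalfspaceLearning.psi (HalfspaceLearning.cone x y) (f (x, y))
            ∂(HalfspaceLearning.sampleLaw n m)) ∧
    -- labeled samples whose cone has empty interior contribute nothing
    (∀ (x : Fin m → HalfspaceLearning.Sph n) (y : Fin m → ℤˣ),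
      ¬ (interior (HalfspaceLearning.cone x y)).Nonempty →
        ∀ w, HalfspaceLearning.psi (HalfspaceLearning.cone x y) w = 0) ∧
    ∃ fstar : HalfspaceLearning.Rule n m,
      HalfspaceLearning.IsOptimal s₀ fstar ∧
      -- on every cone with nonempty interior, `fstar` is the unique minimizer of `ψ`; it lies in
      -- the cone generated by the signed examples, and there is no other local minimum
      (∀ (x : Fin m → HalfspaceLearning.Sph n) (y : Fin m → ℤˣ),
        (interior (HalfspaceLearning.cone x y)).Nonempty →
          (∀ w, HalfspaceLearning.psi (HalfspaceLearning.cone x y) (fstar (x, y)) ≤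
            HalfspaceLearning.psi (HalfspaceLearning.cone x y) w) ∧
          (∀ w, (∀ w', HalfspaceLearning.psi (HalfspaceLearning.cone x y) w ≤
            HalfspaceLearning.psi (HalfspaceLearning.cone x y) w') → w = fstar (x, y)) ∧
          (∃ α : Fin m → ℝ, (∀ i, 0 ≤ α i) ∧
            (fstar (x, y) : HalfspaceLearning.E n) =
              ∑ i, α i • HalfspaceLearning.signed x y i) ∧
          (2 ≤ n → ∀ w, IsLocalMin (HalfspaceLearning.psi (HalfspaceLearning.cone x y)) w →
            w = fstar (x, y))) ∧
      -- uniqueness of the optimal rule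
      (∀ f : HalfspaceLearning.Rule n m, Measurable f →
        (HalfspaceLearning.IsOptimal s₀ f ↔
          ∀ᵐ x ∂(HalfspaceLearning.sampleLaw n m), ∀ y : Fin m → ℤˣ,
            (interior (HalfspaceLearning.cone x y)).Nonempty → f (x, y) = fstar (x, y))) ∧
      -- equivariance under orthogonal maps
      (∀ (V : HalfspaceLearning.E n ≃ₗᵢ[ℝ] HalfspaceLearning.E n)
        (x : Fin m → HalfspaceLearning.Sph n) (y : Fin m → ℤˣ),
        fstar (fun i => HalfspaceLearning.act V (x i), y) =
          HalfspaceLearning.act V (fstar (x, y))) := by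
  open HalfspaceLearning in
  refine ⟨disagree_eq_geo_div_pi hn s₀, fun f hf => ⟨?_, integrable_sum_psi hn hf,
    risk_eq hn s₀ hf⟩, fun x y h w => psi_eq_zero_of_interior_empty h w,
    optRule hn hm, isOptimal_optRule hn hm s₀, fun x y h => ?_,
    fun f hf => isOptimal_iff hn hm s₀ hf, optRule_act hn hm⟩
  · simp only [disagree_eq_geo_div_pi hn]
    exact (integrable_geo_label hn s₀ hf).div_const _
  · have hmin := optRule_isMin hn hm h
    have hne : (openCone x y).Nonempty := interior_cone ▸ h
    -- The point v is strictly positive on all signed examples, which is what makes their generated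
    -- cone closed.
    obtain ⟨v, hv⟩ := id hne
    exact ⟨hmin, fun w hw => eq_optRule hn hm h hw,
      exists_nonneg_combination hv fun b hb => inner_nonneg_of_isMin hn hm hne hmin hb,
      fun hn2 w hw => eq_of_isLocalMin hn2 hm hne hw hmin⟩
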